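/- Let $n\ge 2$. For $\beta\in(0,2\pi)$ let $$\mathcal A_\beta=\{x\in\mathbb R^n:\ \theta_1,\dots,\theta_{n-2}\in(0,\pi),\ \theta_{n-1}\in(0,\beta)\}$$ be the infinite sector of amplitude $\beta$, where $(r,\theta_1,\dots,\theta_{n-1})$, $r>0$, are the usual polar coordinates in $\mathbb R^n$, i.e. $x_k=r\sin\theta_1\cdots\sin\theta_{k-1}\cos\theta_k$ for $1\le k\le n-1$ and $x_n=r\sin\theta_1\cdots\sin\theta_{n-1}$. For an open set $\Omega\subset\mathbb R^n$ and $\Gamma_1\subset\partial\Omega$, let $H^1_0(\Omega\cup\Gamma_1)$ denote the closure in $W^{1,2}(\Omega)$ of the restrictions to $\Omega$ of the functions in $C_c^\infty(\mathbb R^n)$ whose support does not meet $\Gamma_0:=\partial\Omega\setminus\Gamma_1$. For every $n\ge2$ and every $c_0>0$ there is a constant $\eta>0$, depending only on $n$ and $c_0$, with the following property. Let $\beta\in(0,2\pi)$, let $\Omega\subset\mathcal A_\beta$ be open (bounded or unbounded, not necessarily connected), let $\Gamma_1\subset\partial\Omega\cap\partial\mathcal A_\beta$, and let $c\in L^\infty(\Omega)$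 satisfy $\|c^+\|_{L^\infty(\Omega)}<c_0$. Let $w\in W^{1,2}(\Omega)$ be such that $w^+=\max(w,0)\in H^1_0(\Omega\cup\Gamma_1)$ and $$\int_\Omega\nabla w\cdot\nabla\phi\,dx-\int_\Omega c\,w\,\phi\,dx\le 0\qquad\text{for all }\phi\in H^1_0(\Omega\cup\Gamma_1)\text{ with }\phi\ge0$$ (that is, weakly, $\Delta w+cw\ge0$ in $\Omega$, $w\le0$ on $\Gamma_0$ and $\partial_\nu w\le0$ on $\Gamma_1$). If $$\operatorname{meas}(\Omega)<\eta\beta,$$ then $w\le0$ almost everywhere in $\Omega$. -/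

import Mathlib

open Set Filter Topology MeasureTheory
open scoped ContDiff

/-- The point of `ℝⁿ` with polar coordinates `(r, θ₁, …, θ_{n-1})`; the angle `θ_{j+1}` of the
mathematical notation is `θ j`, and only `θ 0, …, θ (n - 2)` are used:
`x₁ = r cos θ₁`, `x₂ = r sin θ₁ cos θ₂`, …, `x_{n-1} = r sin θ₁ ⋯ sin θ_{n-2} cos θ_{n-1}`,
`x_n = r sin θ₁ ⋯ sin θ_{n-2} sin θ_{n-1}`. -/
noncomputable def polarPoint (n : ℕ) (r : ℝ) (θ : ℕ → ℝ) : EuclideanSpace ℝ (Fin n) :=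
  WithLp.toLp 2 fun k : Fin n =>
    r * (∏ j ∈ Finset.range (k : ℕ), Real.sin (θ j)) *
      (if (k : ℕ) + 1 < n then Real.cos (θ k) else 1)

/-- The infinite open sector of amplitude `β` in `ℝⁿ` (`n ≥ 2`): the points whose polar
coordinates satisfy `r > 0`, `θ₁, …, θ_{n-2} ∈ (0, π)` and `θ_{n-1} ∈ (0, β)`. -/
def sector (n : ℕ) (β : ℝ) : Set (EuclideanSpace ℝ (Fin n)) :=
  {x | ∃ (r : ℝ) (θ : ℕ → ℝ), 0 < r ∧ (∀ j < n - 2, θ j ∈ Ioo 0 Real.pi) ∧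
    θ (n - 2) ∈ Ioo 0 β ∧ x = polarPoint n r θ}

/-- `u` belongs to the Sobolev space `W^{1,2}(Ω)` and `Du` is (a version of) its weak gradient.
Only the values on `Ω` matter. -/
structure IsSobolevW12 {n : ℕ} (Ω : Set (EuclideanSpace ℝ (Fin n)))
    (u : EuclideanSpace ℝ (Fin n) → ℝ)
    (Du : EuclideanSpace ℝ (Fin n) → EuclideanSpace ℝ (Fin n)) : Prop where
  memLp : MemLp u 2 (volume.restrict Ω)
  memLp_grad : MemLp Du 2 (volume.restrict Ω)
  weak_grad : ∀ ψ : EuclideanSpace ℝ (Fin n) → ℝ,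
    ContDiff ℝ ∞ ψ → HasCompactSupport ψ → tsupport ψ ⊆ Ω →
      ∫ x in Ω, u x • gradient ψ x = - ∫ x in Ω, ψ x • Du x

/-- `u` (with weak gradient `Du`) belongs to `H¹₀(Ω ∪ Γ₁)`, where `Γ₁ ⊆ ∂Ω`: the closure in
`W^{1,2}(Ω)` of the restrictions to `Ω` of those functions in `C_c^∞(ℝⁿ)` whose support does not
meet the remaining part `∂Ω \ Γ₁` of the boundary. -/
structure IsSobolevH10 {n : ℕ} (Ω Γ₁ : Set (EuclideanSpace ℝ (Fin n)))
    (u : EuclideanSpace ℝ (Fin n) → ℝ)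
    (Du : EuclideanSpace ℝ (Fin n) → EuclideanSpace ℝ (Fin n)) : Prop where
  sobolev : IsSobolevW12 Ω u Du
  approx : ∃ Φ : ℕ → EuclideanSpace ℝ (Fin n) → ℝ,
    (∀ k, ContDiff ℝ ∞ (Φ k) ∧ HasCompactSupport (Φ k) ∧
      Disjoint (tsupport (Φ k)) (frontier Ω \ Γ₁)) ∧
    Tendsto (fun k => eLpNorm (fun x => Φ k x - u x) 2 (volume.restrict Ω)) atTop (𝓝 0) ∧
    Tendsto (fun k => eLpNorm (fun x => gradient (Φ k) x - Du x) 2 (volume.restrict Ω))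
      atTop (𝓝 0)

/-! The core is a Poincaré inequality `∫_Ω Φ² ≤ 4ρ² ∫_Ω |∇Φ|²` for smooth `Φ` vanishing near `Γ₀`,
valid with `ρ` as small as desired once `|Ω| < ηβ` (`exists_poincare_sector`). It comes from
averaging over translations. Let `C` be a convex cone, `K ⊆ C` a set of diameter scale `ρ` with `|K|
≥ 2|Ω|`, and `v` the extension of `Φ` by zero to `C`. For each `x`, at least half of the `s ∈ K`
move `x` out of `Ω`, where `v = 0`, so `|K| v(x)² ≤ 2 ∫_K |v(x+s) - v(x)|² ds`. Integrating in `x`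
bounds the right side by `2ρ²|K| ∫ |∇v|²`, because `C` is stable under these translations
(`lintegral_sq_le_of_translate`).

For `β ≤ π` the sector is a convex cone and contains a box `K` of volume proportional to `β`
(`exists_box`). For `β > π` it is a union of two half-spaces, each of which contains balls of radius
`ρ/2`.

The inequality passes to `H¹₀(Ω ∪ Γ₁)` by density. Testing the differential inequality with `w⁺`,
and using `∇w · ∇w⁺ = |∇w⁺|²` (`IsSobolevH10.inner_grad_posPart`), gives `∫ |∇w⁺|² ≤ c₀ ∫ (w⁺)²`.
With `ρ` chosen so that `4ρ²c₀ = 1/2`, this forces `w⁺ = 0`. -/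

theorem sq_lintegral_le_lintegral_sq {α : Type*} [MeasurableSpace α] (μ : Measure α)
    [IsProbabilityMeasure μ] {f : α → ENNReal} (hf : AEMeasurable f μ) :
    (∫⁻ a, f a ∂μ) ^ 2 ≤ ∫⁻ a, f a ^ 2 ∂μ := by
  have h := ENNReal.lintegral_mul_le_Lp_mul_Lq μ (p := 2) (q := 2)
    (Real.holderConjugate_iff.2 (by norm_num)) hf (aemeasurable_const (b := (1 : ENNReal)))
  simp only [Pi.mul_apply, mul_one, ENNReal.one_rpow, lintegral_const, measure_univ] at h
  calc (∫⁻ a, f a ∂μ) ^ 2 ≤ ((∫⁻ a, f a ^ (2 : ℝ) ∂μ) ^ (1 / 2 : ℝ)) ^ 2 := by gcongr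
    _ = ∫⁻ a, f a ^ (2 : ℝ) ∂μ := by
      rw [← ENNReal.rpow_natCast, ← ENNReal.rpow_mul]; norm_num
    _ = ∫⁻ a, f a ^ 2 ∂μ := by simp

theorem lintegral_translate_le {E : Type*} [AddGroup E] [MeasurableSpace E]
    [MeasurableAdd E] (μ : Measure E) [μ.IsAddRightInvariant] {C : Set E} (hC : MeasurableSet C) (F : E → ENNReal) {s : E}
    (hs : ∀ x ∈ C, x + s ∈ C) : ∫⁻ x in C, F (x + s) ∂μ ≤ ∫⁻ x in C, F x ∂μ := by
  rw [← lintegral_indicator hC, ← lintegral_indicator hC,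
    ← lintegral_add_right_eq_self (C.indicator F) s]
  refine lintegral_mono fun x => ?_
  by_cases hx : x ∈ C
  · simp [hx, hs x hx]
  · simp [hx]

/-! ### Poincaré inequality by averaging over translations -/

section Cone

variable {E : Type*} [NormedAddCommGroup E] [InnerProductSpace ℝ E] [FiniteDimensional ℝ E]
  [MeasurableSpace E] [BorelSpace E]

theorem enorm_sub_sq_le_lintegral_gradient {C : Set E} {v : E → ℝ} {g : E → E}
    (hv : ∀ x ∈ C, HasGradientAt v (g x) x) (hg : ContinuousOn g C) (hgm : Measurable g)
    {x s : E} (hs : ∀ t ∈ Icc (0 : ℝ) 1, x + t • s ∈ C) :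
    ‖v (x + s) - v x‖ₑ ^ 2 ≤ ‖s‖ₑ ^ 2 * ∫⁻ t in Ioc (0 : ℝ) 1, ‖g (x + t • s)‖ₑ ^ 2 := by
  have hline : Continuous fun t : ℝ => x + t • s := by fun_prop
  have hderiv : ∀ t ∈ uIcc (0 : ℝ) 1,
      HasDerivAt (fun t : ℝ => v (x + t • s)) (inner ℝ (g (x + t • s)) s) t := by
    intro t ht
    rw [uIcc_of_le zero_le_one] at ht
    have h1 : HasDerivAt (fun t : ℝ => x + t • s) s t := by
      simpa using ((hasDerivAt_id t).smul_const s).const_add x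
    exact (hv _ (hs t ht)).hasFDerivAt.comp_hasDerivAt t h1
  have hcont : ContinuousOn (fun t : ℝ => inner ℝ (g (x + t • s)) s) (Icc (0 : ℝ) 1) :=
    (hg.comp hline.continuousOn hs).inner continuousOn_const
  have hftc := intervalIntegral.integral_eq_sub_of_hasDerivAt hderiv
    (hcont.intervalIntegrable_of_Icc zero_le_one)
  simp only [one_smul, zero_smul, add_zero] at hftc
  have : IsProbabilityMeasure (volume.restrict (Ioc (0 : ℝ) 1)) := ⟨by simp⟩
  have hmeas : Measurable fun t : ℝ => ‖g (x + t • s)‖ₑ := (hgm.comp hline.measurable).enorm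
  have h1 : ‖v (x + s) - v x‖ₑ ≤ ‖s‖ₑ * ∫⁻ t in Ioc (0 : ℝ) 1, ‖g (x + t • s)‖ₑ := by
    rw [← hftc, intervalIntegral.integral_of_le zero_le_one, ← lintegral_const_mul _ hmeas]
    refine (enorm_integral_le_lintegral_enorm _).trans (lintegral_mono fun t => ?_)
    rw [mul_comm, ← ofReal_norm, ← ofReal_norm, ← ofReal_norm,
      ← ENNReal.ofReal_mul (norm_nonneg _)]
    exact ENNReal.ofReal_le_ofReal (norm_inner_le_norm _ _)
  calc ‖v (x + s) - v x‖ₑ ^ 2 ≤ (‖s‖ₑ * ∫⁻ t in Ioc (0 : ℝ) 1, ‖g (x + t • s)‖ₑ) ^ 2 := by gcongr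
    _ = ‖s‖ₑ ^ 2 * (∫⁻ t in Ioc (0 : ℝ) 1, ‖g (x + t • s)‖ₑ) ^ 2 := by ring
    _ ≤ _ := by
      gcongr
      exact sq_lintegral_le_lintegral_sq _ hmeas.aemeasurable

variable (μ : Measure E) [μ.IsAddHaarMeasure]

/-- Integrate the segment estimate over `C` and exchange integrals; each translate by `t • s` maps
`C` into itself, so it does not increase the integral of `|g|²`. -/
theorem lintegral_enorm_sub_translate_sq_le {C : Set E} (hC : MeasurableSet C) {v : E → ℝ}
    {g : E → E} (hv : ∀ x ∈ C, HasGradientAt v (g x) x) (hg : ContinuousOn g C)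
    (hgm : Measurable g) {s : E} (hs : ∀ x ∈ C, ∀ t ∈ Icc (0 : ℝ) 1, x + t • s ∈ C) :
    ∫⁻ x in C, ‖v (x + s) - v x‖ₑ ^ 2 ∂μ ≤ ‖s‖ₑ ^ 2 * ∫⁻ x in C, ‖g x‖ₑ ^ 2 ∂μ := by
  have hF : Measurable fun p : E × ℝ => ‖g (p.1 + p.2 • s)‖ₑ ^ 2 :=
    ((hgm.comp (by fun_prop)).enorm.pow_const 2)
  calc ∫⁻ x in C, ‖v (x + s) - v x‖ₑ ^ 2 ∂μ
      ≤ ∫⁻ x in C, (‖s‖ₑ ^ 2 * ∫⁻ t in Ioc (0 : ℝ) 1, ‖g (x + t • s)‖ₑ ^ 2) ∂μ :=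
        setLIntegral_mono' hC fun x hx => enorm_sub_sq_le_lintegral_gradient hv hg hgm (hs x hx)
    _ = ‖s‖ₑ ^ 2 * ∫⁻ x in C, (∫⁻ t in Ioc (0 : ℝ) 1, ‖g (x + t • s)‖ₑ ^ 2) ∂μ :=
        lintegral_const_mul _ hF.lintegral_prod_right'
    _ = ‖s‖ₑ ^ 2 * ∫⁻ t in Ioc (0 : ℝ) 1, ∫⁻ x in C, ‖g (x + t • s)‖ₑ ^ 2 ∂μ := by
        rw [lintegral_lintegral_swap hF.aemeasurable]
    _ ≤ ‖s‖ₑ ^ 2 * ∫⁻ t in Ioc (0 : ℝ) 1, ∫⁻ x in C, ‖g x‖ₑ ^ 2 ∂μ := by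
        gcongr ‖s‖ₑ ^ 2 * ?_
        exact setLIntegral_mono' measurableSet_Ioc fun t ht =>
          lintegral_translate_le μ hC (fun x => ‖g x‖ₑ ^ 2) fun x hx =>
            hs x hx t (Ioc_subset_Icc_self ht)
    _ = _ := by simp

/-- Poincaré inequality for functions supported in a set of small measure, on a set `C` that is
stable under the translations by the elements of a bounded set `K`. -/
theorem lintegral_sq_le_of_translate {C K Ω : Set E} (hC : MeasurableSet C)
    (hK : MeasurableSet K) (hΩ : MeasurableSet Ω) (hK0 : μ K ≠ 0) (hKtop : μ K ≠ ⊤)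
    (hΩK : 2 * μ Ω ≤ μ K) {ρ : ENNReal} (hKρ : ∀ s ∈ K, ‖s‖ₑ ≤ ρ)
    (hKC : ∀ s ∈ K, ∀ x ∈ C, ∀ t ∈ Icc (0 : ℝ) 1, x + t • s ∈ C)
    {v : E → ℝ} {g : E → E} (hvm : Measurable v) (hv0 : ∀ x ∉ Ω, v x = 0)
    (hv : ∀ x ∈ C, HasGradientAt v (g x) x) (hg : ContinuousOn g C) (hgm : Measurable g) :
    ∫⁻ x in C, ‖v x‖ₑ ^ 2 ∂μ ≤ 2 * ρ ^ 2 * ∫⁻ x in C, ‖g x‖ₑ ^ 2 ∂μ := by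
  have hF : Measurable fun p : E × E => ‖v (p.1 + p.2) - v p.1‖ₑ ^ 2 :=
    (((hvm.comp (by fun_prop)).sub (hvm.comp measurable_fst)).enorm.pow_const 2)
  have hpt : ∀ x, μ K * ‖v x‖ₑ ^ 2 ≤ 2 * ∫⁻ s in K, ‖v (x + s) - v x‖ₑ ^ 2 ∂μ := by
    intro x
    have hT : MeasurableSet ((fun s => x + s) ⁻¹' Ω) := hΩ.preimage (by fun_prop)
    -- `B` collects the translations that move `x` out of `Ω`. The excluded set has measure at most
    -- `μ Ω ≤ μ K / 2`, so `B` fills at least half of `K`.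
    set B := K \ ((fun s => x + s) ⁻¹' Ω) with hB
    have hBm : MeasurableSet B := hK.diff hT
    have hKB : μ K ≤ 2 * μ B := by
      have h1 : μ K ≤ μ Ω + μ B := by
        calc μ K ≤ μ ((fun s => x + s) ⁻¹' Ω ∪ B) := measure_mono (by
              intro s hs; by_cases h : s ∈ (fun s => x + s) ⁻¹' Ω
              · exact Or.inl h
              · exact Or.inr ⟨hs, h⟩)
          _ ≤ _ := measure_union_le _ _
          _ = _ := by rw [measure_preimage_add]
      have h2 : μ K + μ K ≤ μ K + 2 * μ B := by
        calc μ K + μ K ≤ (μ Ω + μ B) + (μ Ω + μ B) := by gcongr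
          _ = 2 * μ Ω + 2 * μ B := by ring
          _ ≤ _ := by gcongr
      exact (ENNReal.add_le_add_iff_left hKtop).1 h2
    calc μ K * ‖v x‖ₑ ^ 2 ≤ 2 * μ B * ‖v x‖ₑ ^ 2 := by gcongr
      _ = 2 * ∫⁻ s in B, ‖v x‖ₑ ^ 2 ∂μ := by rw [setLIntegral_const]; ring
      _ = 2 * ∫⁻ s in B, ‖v (x + s) - v x‖ₑ ^ 2 ∂μ := by
        congr 1
        refine setLIntegral_congr_fun hBm fun s hs => ?_
        simp only [hv0 _ hs.2, zero_sub, enorm_neg]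
      _ ≤ _ := by
        gcongr 2 * ?_
        exact lintegral_mono_set sdiff_subset
  have hmain : μ K * ∫⁻ x in C, ‖v x‖ₑ ^ 2 ∂μ ≤
      μ K * (2 * ρ ^ 2 * ∫⁻ x in C, ‖g x‖ₑ ^ 2 ∂μ) := by
    calc μ K * ∫⁻ x in C, ‖v x‖ₑ ^ 2 ∂μ = ∫⁻ x in C, μ K * ‖v x‖ₑ ^ 2 ∂μ :=
          (lintegral_const_mul _ (hvm.enorm.pow_const 2)).symm
      _ ≤ ∫⁻ x in C, 2 * ∫⁻ s in K, ‖v (x + s) - v x‖ₑ ^ 2 ∂μ ∂μ := lintegral_mono hpt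
      _ = 2 * ∫⁻ x in C, ∫⁻ s in K, ‖v (x + s) - v x‖ₑ ^ 2 ∂μ ∂μ :=
          lintegral_const_mul _ hF.lintegral_prod_right'
      _ = 2 * ∫⁻ s in K, ∫⁻ x in C, ‖v (x + s) - v x‖ₑ ^ 2 ∂μ ∂μ := by
          rw [lintegral_lintegral_swap hF.aemeasurable]
      _ ≤ 2 * ∫⁻ s in K, ρ ^ 2 * ∫⁻ x in C, ‖g x‖ₑ ^ 2 ∂μ ∂μ := by
          gcongr 2 * ?_
          refine setLIntegral_mono' hK fun s hs => ?_
          refine (lintegral_enorm_sub_translate_sq_le μ hC hv hg hgm (hKC s hs)).trans ?_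
          gcongr
          exact hKρ s hs
      _ = _ := by rw [setLIntegral_const]; ring
  exact (ENNReal.mul_le_mul_iff_right hK0 hKtop).1 hmain

end Cone

/-! ### Extension by zero from `Ω` to the cone -/

section Extension

variable {E : Type*} [NormedAddCommGroup E] [InnerProductSpace ℝ E] [CompleteSpace E]

theorem ContDiff.continuous_gradient {Φ : E → ℝ} (hΦ : ContDiff ℝ ∞ Φ) :
    Continuous (gradient Φ) :=
  (InnerProductSpace.toDual ℝ E).symm.continuous.comp (hΦ.continuous_fderiv (by simp))

/-- Such a point is in `Ω`, off the closure of `Ω`, or on the boundary but off the support. In the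
last two cases everything vanishes nearby, so the zero extension has no jump at these points. -/
theorem indicator_gradient_eventuallyEq {Ω : Set E} (hΩ : IsOpen Ω) {Φ : E → ℝ} {x : E}
    (hx : x ∉ frontier Ω ∩ tsupport Φ) :
    (Ω.indicator Φ =ᶠ[𝓝 x] Φ ∧ Ω.indicator (gradient Φ) =ᶠ[𝓝 x] gradient Φ) ∨
    (Ω.indicator Φ =ᶠ[𝓝 x] (fun _ => 0) ∧ Ω.indicator (gradient Φ) =ᶠ[𝓝 x] fun _ => 0) := by
  by_cases h1 : x ∈ Ω
  · left
    constructor <;> filter_upwards [hΩ.mem_nhds h1] with y hy using indicator_of_mem hy _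
  right
  by_cases h2 : x ∈ closure Ω
  · have h3 : x ∉ tsupport Φ := fun h => hx ⟨by rw [hΩ.frontier_eq]; exact ⟨h2, h1⟩, h⟩
    have h4 : ∀ᶠ y in 𝓝 x, Φ =ᶠ[𝓝 y] fun _ => (0 : ℝ) :=
      eventually_eventually_nhds.2 (notMem_tsupport_iff_eventuallyEq.1 h3)
    constructor
    · filter_upwards [h4] with y hy
      simp [indicator, hy.self_of_nhds]
    · filter_upwards [h4] with y hy
      have h5 : gradient Φ y = 0 := by rw [hy.gradient_eq, gradient_fun_const]
      simp [indicator, h5]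
  · have h3 : ∀ᶠ y in 𝓝 x, y ∉ Ω := by
      filter_upwards [isClosed_closure.isOpen_compl.mem_nhds h2] with y hy hyΩ
      exact hy (subset_closure hyΩ)
    constructor <;> filter_upwards [h3] with y hy using indicator_of_notMem hy _

theorem hasGradientAt_indicator {Ω : Set E} (hΩ : IsOpen Ω) {Φ : E → ℝ} (hΦ : ContDiff ℝ ∞ Φ)
    {x : E} (hx : x ∉ frontier Ω ∩ tsupport Φ) :
    HasGradientAt (Ω.indicator Φ) (Ω.indicator (gradient Φ) x) x := by
  rcases indicator_gradient_eventuallyEq hΩ hx with ⟨h1, h2⟩ | ⟨h1, h2⟩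
  · rw [h2.self_of_nhds]
    exact ((hΦ.differentiable (by simp)) x).hasGradientAt.congr_of_eventuallyEq h1
  · rw [h2.self_of_nhds]
    exact (hasGradientAt_const x (0 : ℝ)).congr_of_eventuallyEq h1

theorem continuousAt_indicator_gradient {Ω : Set E} (hΩ : IsOpen Ω) {Φ : E → ℝ}
    (hΦ : ContDiff ℝ ∞ Φ) {x : E} (hx : x ∉ frontier Ω ∩ tsupport Φ) :
    ContinuousAt (Ω.indicator (gradient Φ)) x := by
  rcases indicator_gradient_eventuallyEq hΩ hx with ⟨-, h2⟩ | ⟨-, h2⟩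
  · exact hΦ.continuous_gradient.continuousAt.congr h2.symm
  · exact continuousAt_const.congr h2.symm

variable [FiniteDimensional ℝ E] [MeasurableSpace E] [BorelSpace E]
  (μ : Measure E) [μ.IsAddHaarMeasure]

theorem lintegral_sq_le_on_cone {C K Ω : Set E} (hC : IsOpen C)
    (hCadd : ∀ x ∈ C, ∀ s ∈ C, ∀ t : ℝ, 0 ≤ t → x + t • s ∈ C) (hKC : K ⊆ C)
    (hK : MeasurableSet K) (hK0 : μ K ≠ 0) (hKtop : μ K ≠ ⊤) {ρ : ℝ}
    (hKρ : ∀ s ∈ K, ‖s‖ ≤ ρ) (hΩ : IsOpen Ω) (hΩK : 2 * μ Ω ≤ μ K)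
    {Φ : E → ℝ} (hΦ : ContDiff ℝ ∞ Φ) (hdisj : ∀ x ∈ C, x ∉ frontier Ω ∩ tsupport Φ) :
    ∫⁻ x in C, ‖Ω.indicator Φ x‖ₑ ^ 2 ∂μ ≤
      2 * ENNReal.ofReal ρ ^ 2 * ∫⁻ x in Ω, ‖gradient Φ x‖ₑ ^ 2 ∂μ := by
  refine (lintegral_sq_le_of_translate μ (C := C) (K := K) (Ω := Ω) hC.measurableSet hK
    hΩ.measurableSet hK0 hKtop hΩK (ρ := ENNReal.ofReal ρ) (g := Ω.indicator (gradient Φ))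
    ?_ ?_ ?_ ?_ ?_ ?_ ?_).trans ?_
  · intro s hs
    rw [← ofReal_norm]
    exact ENNReal.ofReal_le_ofReal (hKρ s hs)
  · exact fun s hs x hx t ht => hCadd x hx s (hKC hs) t ht.1
  · exact hΦ.continuous.measurable.indicator hΩ.measurableSet
  · exact fun x hx => indicator_of_notMem hx _
  · exact fun x hx => hasGradientAt_indicator hΩ hΦ (hdisj x hx)
  · exact fun x hx =>
      (continuousAt_indicator_gradient hΩ hΦ (hdisj x hx)).continuousWithinAt
  · exact hΦ.continuous_gradient.measurable.indicator hΩ.measurableSet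
  · gcongr 2 * ENNReal.ofReal ρ ^ 2 * ?_
    rw [← lintegral_indicator hΩ.measurableSet]
    refine (setLIntegral_le_lintegral _ _).trans (lintegral_mono fun x => ?_)
    by_cases hx : x ∈ Ω <;> simp [hx]

end Extension

/-! ### Polar coordinates and the planar description of the sector -/

theorem exists_polar (x y : ℝ) : ∃ s t : ℝ, 0 ≤ s ∧ t ∈ Ioc (-Real.pi) Real.pi ∧
    x = s * Real.cos t ∧ y = s * Real.sin t :=
  ⟨‖(⟨x, y⟩ : ℂ)‖, Complex.arg ⟨x, y⟩, norm_nonneg _, Complex.arg_mem_Ioc _,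
    (Complex.norm_mul_cos_arg ⟨x, y⟩).symm, (Complex.norm_mul_sin_arg ⟨x, y⟩).symm⟩

theorem exists_polar_of_pos (x : ℝ) {y : ℝ} (hy : 0 < y) : ∃ s t : ℝ, 0 < s ∧
    t ∈ Ioo 0 Real.pi ∧ x = s * Real.cos t ∧ y = s * Real.sin t := by
  obtain ⟨s, t, hs, ht, hx, hy'⟩ := exists_polar x y
  have hs' : 0 < s := by
    rcases hs.eq_or_lt with h | h
    · simp [← h] at hy'; exact absurd hy' hy.ne'
    · exact h
  have hsin : 0 < Real.sin t := by
    by_contra h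
    nlinarith [mul_nonneg hs (sub_nonneg.2 (not_lt.1 h))]
  refine ⟨s, t, hs', ⟨?_, ?_⟩, hx, hy'⟩
  · by_contra h
    exact absurd hsin (not_lt.2 (Real.sin_nonpos_of_nonpos_of_neg_pi_le (not_lt.1 h) ht.1.le))
  · refine lt_of_le_of_ne ht.2 fun h => ?_
    simp [h] at hsin

/-- Angles are peeled off from the last one: planar polar coordinates of `(a k, b)` give an angle in
`(0, π)` and a positive radius, which replaces `b` in the induction. -/
theorem exists_polar_angles (k : ℕ) (a : ℕ → ℝ) {b : ℝ} (hb : 0 < b) :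
    ∃ (r : ℝ) (θ : ℕ → ℝ), 0 < r ∧ (∀ j < k, θ j ∈ Ioo 0 Real.pi) ∧
      (∀ j < k, a j = r * (∏ i ∈ Finset.range j, Real.sin (θ i)) * Real.cos (θ j)) ∧
      b = r * ∏ i ∈ Finset.range k, Real.sin (θ i) := by
  induction k generalizing b with
  | zero => exact ⟨b, 0, hb, by simp, by simp, by simp⟩
  | succ k ih =>
    obtain ⟨s, t, hs, ht, hak, hbs⟩ := exists_polar_of_pos (a k) hb
    obtain ⟨r, θ, hr, hθ, ha, hs'⟩ := ih hs
    have hprod : ∀ j ≤ k, ∏ i ∈ Finset.range j, Real.sin (Function.update θ k t i) =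
        ∏ i ∈ Finset.range j, Real.sin (θ i) := fun j hj =>
      Finset.prod_congr rfl fun i hi => by
        rw [Function.update_of_ne (by have := Finset.mem_range.1 hi; omega)]
    refine ⟨r, Function.update θ k t, hr, fun j hj => ?_, fun j hj => ?_, ?_⟩
    · rcases (Nat.lt_succ_iff.1 hj).eq_or_lt with rfl | h
      · simpa using ht
      · rw [Function.update_of_ne h.ne]; exact hθ j h
    · rw [hprod j (Nat.lt_succ_iff.1 hj)]
      rcases (Nat.lt_succ_iff.1 hj).eq_or_lt with rfl | h
      · rw [← hs']; simpa using hak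
      · rw [Function.update_of_ne h.ne]; exact ha j h
    · rw [Finset.prod_range_succ, hprod k le_rfl, ← mul_assoc, ← hs']; simpa using hbs

/-- The sector is a cylinder over a planar sector: the first `m` coordinates are unconstrained. -/
theorem mem_sector_iff {m : ℕ} {β : ℝ} {x : EuclideanSpace ℝ (Fin (m + 2))} :
    x ∈ sector (m + 2) β ↔ ∃ s t : ℝ, 0 < s ∧ t ∈ Ioo 0 β ∧
      x ⟨m, by omega⟩ = s * Real.cos t ∧ x ⟨m + 1, by omega⟩ = s * Real.sin t := by
  constructor
  · rintro ⟨r, θ, hr, hθ, ht, rfl⟩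
    simp only [Nat.add_sub_cancel] at hθ ht
    refine ⟨r * ∏ j ∈ Finset.range m, Real.sin (θ j), θ m,
      mul_pos hr (Finset.prod_pos fun j hj => ?_), ht, ?_, ?_⟩
    · have := hθ j (Finset.mem_range.1 hj)
      exact Real.sin_pos_of_pos_of_lt_pi this.1 this.2
    · simp [polarPoint]
    · simp [polarPoint, Finset.prod_range_succ, mul_assoc]
  · rintro ⟨s, t, hs, ht, hp, hq⟩
    obtain ⟨r, θ, hr, hθ, ha, hb⟩ :=
      exists_polar_angles m (fun j => if h : j < m + 2 then x ⟨j, h⟩ else 0) hs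
    have hprod : ∀ j ≤ m, ∏ i ∈ Finset.range j, Real.sin (Function.update θ m t i) =
        ∏ i ∈ Finset.range j, Real.sin (θ i) := fun j hj =>
      Finset.prod_congr rfl fun i hi => by
        rw [Function.update_of_ne (by have := Finset.mem_range.1 hi; omega)]
    refine ⟨r, Function.update θ m t, hr, fun j hj => ?_, by simpa using ht, ?_⟩
    · rw [Nat.add_sub_cancel] at hj
      rw [Function.update_of_ne hj.ne]
      exact hθ j hj
    · ext ⟨k, hk⟩
      rcases lt_trichotomy k m with h | rfl | h
      · have h' := ha k h
        simp only [hk, dif_pos] at h'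
        simp [polarPoint, hprod k h.le, Function.update_of_ne h.ne, h']
        omega
      · simp [polarPoint, hprod k le_rfl, ← hb, hp]
      · obtain rfl : k = m + 1 := by omega
        simp [polarPoint, Finset.prod_range_succ, hprod m le_rfl, ← mul_assoc, ← hb, hq]

/-- For acute `β` this is `β < tan β`; otherwise `cos β ≤ 0 ≤ sin β`, and the two do not vanish
together. It places the box of `exists_box` below the face `θ_{n-1} = β`. -/
theorem mul_cos_lt_mul_sin {β a b : ℝ} (hβ : β ∈ Ioc 0 Real.pi) (hb : 0 < b) (ha : 0 < a)
    (hab : b < β * a) : b * Real.cos β < a * Real.sin β := by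
  rcases lt_or_ge β (Real.pi / 2) with h | h
  · have hcos : 0 < Real.cos β := Real.cos_pos_of_mem_Ioo ⟨by linarith [hβ.1, Real.pi_pos], h⟩
    have h1 : β * Real.cos β < Real.sin β := by
      have := Real.lt_tan hβ.1 h
      rwa [Real.tan_eq_sin_div_cos, lt_div_iff₀ hcos] at this
    nlinarith
  · have hsin : 0 ≤ Real.sin β := Real.sin_nonneg_of_nonneg_of_le_pi hβ.1.le hβ.2
    have hcos : Real.cos β ≤ 0 :=
      Real.cos_nonpos_of_pi_div_two_le_of_le h (by linarith [hβ.2, Real.pi_pos])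
    have hsq := Real.sin_sq_add_cos_sq β
    rcases hcos.eq_or_lt with h0 | h0
    · have : 0 < Real.sin β := by
        rcases hsin.eq_or_lt with h1 | h1
        · rw [h0, ← h1] at hsq; norm_num at hsq
        · exact h1
      rw [h0]; nlinarith
    · nlinarith [mul_nonneg ha.le hsin, mul_pos hb (neg_pos.2 h0)]

/-! ### The sector through half-spaces, and its Poincaré inequality -/

section Sector

variable {m : ℕ}

/-- The inner normal of the face `θ_{n-1} = 0` of the sector. -/
noncomputable def lowerNormal (m : ℕ) : EuclideanSpace ℝ (Fin (m + 2)) :=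
  EuclideanSpace.single ⟨m + 1, by omega⟩ 1

/-- The inner normal of the face `θ_{n-1} = β` of the sector. -/
noncomputable def upperNormal (m : ℕ) (β : ℝ) : EuclideanSpace ℝ (Fin (m + 2)) :=
  EuclideanSpace.single ⟨m, by omega⟩ (Real.sin β) -
    EuclideanSpace.single ⟨m + 1, by omega⟩ (Real.cos β)

theorem inner_lowerNormal (x : EuclideanSpace ℝ (Fin (m + 2))) :
    inner ℝ (lowerNormal m) x = x ⟨m + 1, by omega⟩ := by
  simp [lowerNormal, EuclideanSpace.inner_single_left]

theorem inner_upperNormal (β : ℝ) (x : EuclideanSpace ℝ (Fin (m + 2))) :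
    inner ℝ (upperNormal m β) x =
      x ⟨m, by omega⟩ * Real.sin β - x ⟨m + 1, by omega⟩ * Real.cos β := by
  simp [upperNormal, inner_sub_left, EuclideanSpace.inner_single_left, mul_comm]

theorem norm_lowerNormal : ‖lowerNormal m‖ = 1 := by
  simp [lowerNormal]

theorem norm_upperNormal (β : ℝ) : ‖upperNormal m β‖ = 1 := by
  have h : inner ℝ (upperNormal m β) (upperNormal m β) = 1 := by
    rw [inner_upperNormal]
    simp [upperNormal]
    nlinarith [Real.sin_sq_add_cos_sq β]
  rw [real_inner_self_eq_norm_sq] at h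
  nlinarith [norm_nonneg (upperNormal m β)]

/-- In planar polar coordinates `(s, t)` the two inner products are `s sin t` and `s sin (β - t)`,
whose signs locate `t`. -/
theorem mem_sector_of_le_pi {β : ℝ} (hβ : β ∈ Ioc 0 Real.pi)
    {x : EuclideanSpace ℝ (Fin (m + 2))} :
    x ∈ sector (m + 2) β ↔
      0 < inner ℝ (lowerNormal m) x ∧ 0 < inner ℝ (upperNormal m β) x := by
  rw [mem_sector_iff, inner_lowerNormal, inner_upperNormal]
  constructor
  · rintro ⟨s, t, hs, ht, hp, hq⟩
    rw [hp, hq]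
    refine ⟨mul_pos hs (Real.sin_pos_of_pos_of_lt_pi ht.1 (ht.2.trans_le hβ.2)), ?_⟩
    have : 0 < Real.sin (β - t) :=
      Real.sin_pos_of_pos_of_lt_pi (by linarith [ht.2]) (by linarith [ht.1, hβ.2])
    rw [Real.sin_sub] at this
    nlinarith
  · rintro ⟨h1, h2⟩
    obtain ⟨s, t, hs, ht, hp, hq⟩ := exists_polar_of_pos (x ⟨m, by omega⟩) h1
    refine ⟨s, t, hs, ⟨ht.1, ?_⟩, hp, hq⟩
    by_contra h
    have : Real.sin (β - t) ≤ 0 :=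
      Real.sin_nonpos_of_nonpos_of_neg_pi_le (by linarith) (by linarith [ht.2, hβ.1])
    rw [Real.sin_sub] at this
    rw [hp, hq] at h2
    nlinarith

theorem mem_sector_of_pi_lt {β : ℝ} (hβ : β ∈ Ioo Real.pi (2 * Real.pi))
    {x : EuclideanSpace ℝ (Fin (m + 2))} :
    x ∈ sector (m + 2) β ↔
      0 < inner ℝ (lowerNormal m) x ∨ 0 < inner ℝ (upperNormal m β) x := by
  rw [mem_sector_iff, inner_lowerNormal, inner_upperNormal]
  constructor
  · rintro ⟨s, t, hs, ht, hp, hq⟩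
    rw [hp, hq]
    rcases lt_or_ge t Real.pi with h | h
    · exact Or.inl (mul_pos hs (Real.sin_pos_of_pos_of_lt_pi ht.1 h))
    · right
      have : 0 < Real.sin (β - t) :=
        Real.sin_pos_of_pos_of_lt_pi (by linarith [ht.2]) (by linarith [hβ.2])
      rw [Real.sin_sub] at this
      nlinarith
  · rintro (h1 | h2)
    · obtain ⟨s, t, hs, ht, hp, hq⟩ := exists_polar_of_pos (x ⟨m, by omega⟩) h1
      exact ⟨s, t, hs, ⟨ht.1, ht.2.trans hβ.1⟩, hp, hq⟩
    · obtain ⟨s, t, hs, ht, hp, hq⟩ := exists_polar (x ⟨m, by omega⟩) (x ⟨m + 1, by omega⟩)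
      have hsin : 0 < s * Real.sin (β - t) := by
        rw [Real.sin_sub]; rw [hp, hq] at h2; linarith
      have hs' : 0 < s := by
        rcases hs.eq_or_lt with h | h
        · simp [← h] at hsin
        · exact h
      have hsin' : 0 < Real.sin (β - t) := pos_of_mul_pos_right hsin hs
      rcases lt_or_ge (β - t) Real.pi with h | h
      · refine ⟨s, t, hs', ⟨by linarith [hβ.1], ?_⟩, hp, hq⟩
        by_contra h'
        exact absurd hsin' (not_lt.2 (Real.sin_nonpos_of_nonpos_of_neg_pi_le (by linarith)
          (by linarith [ht.2, hβ.1, Real.pi_pos])))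
      -- Here the principal argument may lie below `0`; the angle in `(0, β)` is the one a full turn
      -- later.
      · refine ⟨s, t + 2 * Real.pi, hs', ⟨by linarith [ht.1, Real.pi_pos], ?_⟩, ?_, ?_⟩
        · by_contra h'
          have h3 : Real.sin (β - t) = Real.sin (β - t - 2 * Real.pi) := (Real.sin_sub_two_pi _).symm
          rw [h3] at hsin'
          exact absurd hsin' (not_lt.2 (Real.sin_nonpos_of_nonpos_of_neg_pi_le (by linarith)
            (by linarith)))
        · rwa [Real.cos_add_two_pi]
        · rwa [Real.sin_add_two_pi]

theorem isOpen_halfSpace {E : Type*} [NormedAddCommGroup E] [InnerProductSpace ℝ E] (ν : E) :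
    IsOpen {x : E | 0 < inner ℝ ν x} :=
  isOpen_lt continuous_const (by fun_prop)

theorem inner_add_smul_pos {E : Type*} [NormedAddCommGroup E] [InnerProductSpace ℝ E] {ν x s : E}
    (hx : 0 < inner ℝ ν x) (hs : 0 < inner ℝ ν s) {t : ℝ} (ht : 0 ≤ t) :
    0 < inner ℝ ν (x + t • s) := by
  rw [inner_add_right, inner_smul_right]
  positivity

/-- `Γ` lies on the boundary of `A`, hence misses its interior; boundary points of `Ω` inside `C`
thus belong to the part avoided by the support. -/
theorem notMem_frontier_inter_tsupport {X : Type*} [TopologicalSpace X] {A C Ω Γ : Set X}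
    (hC : IsOpen C) (hCA : C ⊆ A) (hΓ : Γ ⊆ frontier Ω ∩ frontier A) {Φ : X → ℝ}
    (hΦ : Disjoint (tsupport Φ) (frontier Ω \ Γ)) : ∀ x ∈ C, x ∉ frontier Ω ∩ tsupport Φ := by
  rintro x hx ⟨hxΩ, hxΦ⟩
  exact disjoint_left.1 hΦ hxΦ ⟨hxΩ, fun hxΓ => (hΓ hxΓ).2.2 (interior_maximal hCA hC hx)⟩

/-- The translations used are the ball of radius `ρ/2` tangent at the origin to the bounding
hyperplane. -/
theorem lintegral_sq_le_on_halfSpace {E : Type*} [NormedAddCommGroup E] [InnerProductSpace ℝ E]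
    [FiniteDimensional ℝ E] [MeasurableSpace E] [BorelSpace E] (μ : Measure E)
    [μ.IsAddHaarMeasure] {ν : E} (hν : ‖ν‖ = 1) {ρ : ℝ} (hρ : 0 < ρ) {Ω : Set E} (hΩ : IsOpen Ω)
    (hΩρ : 2 * μ Ω ≤ μ (Metric.ball 0 (ρ / 2))) {Φ : E → ℝ} (hΦ : ContDiff ℝ ∞ Φ)
    (hdisj : ∀ x, 0 < inner ℝ ν x → x ∉ frontier Ω ∩ tsupport Φ) :
    ∫⁻ x in {x | 0 < inner ℝ ν x}, ‖Ω.indicator Φ x‖ₑ ^ 2 ∂μ ≤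
      2 * ENNReal.ofReal ρ ^ 2 * ∫⁻ x in Ω, ‖gradient Φ x‖ₑ ^ 2 ∂μ := by
  have hball : μ (Metric.ball ((ρ / 2) • ν) (ρ / 2)) = μ (Metric.ball 0 (ρ / 2)) := by
    rw [← Measure.addHaar_ball_center]
  refine lintegral_sq_le_on_cone μ (K := Metric.ball ((ρ / 2) • ν) (ρ / 2)) (isOpen_halfSpace ν)
    (fun x hx s hs t ht => inner_add_smul_pos hx hs ht) ?_ measurableSet_ball
    (Metric.measure_ball_pos μ _ (by positivity)).ne' measure_ball_lt_top.ne ?_ hΩ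
    (hΩρ.trans hball.ge) hΦ hdisj
  · intro s hs
    have h1 : ‖s - (ρ / 2) • ν‖ < ρ / 2 := by simpa [dist_eq_norm] using hs
    have h2 := neg_le_of_abs_le (abs_real_inner_le_norm ν (s - (ρ / 2) • ν))
    rw [inner_sub_right, inner_smul_right, real_inner_self_eq_norm_sq, hν] at h2
    simp only [mem_ofPred_eq]
    linarith
  · intro s hs
    have h1 : ‖s - (ρ / 2) • ν‖ < ρ / 2 := by simpa [dist_eq_norm] using hs
    have h2 := norm_add_le (s - (ρ / 2) • ν) ((ρ / 2) • ν)
    rw [sub_add_cancel, norm_smul, hν, Real.norm_of_nonneg (by positivity)] at h2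
    linarith

theorem exists_box {ρ : ℝ} (hρ : 0 < ρ) : ∃ η : ℝ, 0 < η ∧ ∀ β ∈ Ioc 0 Real.pi,
    ∃ K ⊆ sector (m + 2) β, MeasurableSet K ∧ volume K = ENNReal.ofReal (η * β) ∧
      ∀ s ∈ K, ‖s‖ ≤ ρ := by
  -- All coordinates of the box are at most `4δ` (as `π < 4`), so `16(m+2) ≤ (m+22)²` keeps it in
  -- the ball of radius `ρ`. Only the last side, `βδ`, depends on `β`.
  set δ : ℝ := ρ / (m + 22) with hδ
  have hδ0 : 0 < δ := by positivity
  refine ⟨δ ^ (m + 2), by positivity, fun β hβ => ?_⟩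
  set a : Fin (m + 2) → ℝ := fun i => if (i : ℕ) = m then δ else 0 with ha
  set b : Fin (m + 2) → ℝ := fun i =>
    if (i : ℕ) = m then 2 * δ else if (i : ℕ) = m + 1 then β * δ else δ with hb
  set B : Set (Fin (m + 2) → ℝ) := univ.pi fun i => Ioo (a i) (b i) with hB
  have hBm : MeasurableSet B := MeasurableSet.univ_pi fun i => measurableSet_Ioo
  refine ⟨(MeasurableEquiv.toLp 2 (Fin (m + 2) → ℝ)).symm ⁻¹' B, ?_,
    (MeasurableEquiv.measurable _) hBm, ?_, ?_⟩
  · intro s hs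
    have hs' : ∀ i, s i ∈ Ioo (a i) (b i) := fun i => hs i (mem_univ i)
    have hp := hs' ⟨m, by omega⟩
    have hq := hs' ⟨m + 1, by omega⟩
    simp [ha, hb] at hp hq
    rw [mem_sector_of_le_pi hβ, inner_lowerNormal, inner_upperNormal]
    refine ⟨hq.1, sub_pos.2 (mul_cos_lt_mul_sin hβ hq.1 (hδ0.trans hp.1) ?_)⟩
    nlinarith [hβ.1]
  · rw [(EuclideanSpace.volume_preserving_symm_measurableEquiv_toLp _).measure_preimage
      hBm.nullMeasurableSet, Real.volume_pi_Ioo, ← ENNReal.ofReal_prod_of_nonneg]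
    · congr 1
      rw [Fin.prod_univ_castSucc, Fin.prod_univ_castSucc]
      have : ∏ i : Fin m, (b i.castSucc.castSucc - a i.castSucc.castSucc) = δ ^ m := by
        rw [Finset.prod_congr rfl (g := fun _ => δ)]
        · simp
        · intro i _
          have h1 : (i : ℕ) ≠ m := i.2.ne
          have h2 : (i : ℕ) ≠ m + 1 := by have := i.2; omega
          simp [ha, hb, h1, h2]
      rw [this]
      simp [ha, hb]
      ring
    · intro i _
      have := hβ.1
      simp only [ha, hb]
      split_ifs <;> first | linarith | (simp; positivity)
  · intro s hs
    have hs' : ∀ i, s i ∈ Ioo (a i) (b i) := fun i => hs i (mem_univ i)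
    have h4 : ∀ i, ‖s i‖ ^ 2 ≤ (4 * δ) ^ 2 := by
      intro i
      have ha0 : 0 ≤ a i := by simp only [ha]; split_ifs <;> linarith
      have hb4 : b i ≤ 4 * δ := by
        simp only [hb]
        split_ifs
        · linarith
        · nlinarith [hβ.2, Real.pi_lt_four]
        · linarith
      rw [Real.norm_eq_abs, sq_abs]
      have := hs' i
      exact pow_le_pow_left₀ (ha0.trans this.1.le) (this.2.le.trans hb4) 2
    have h5 : ‖s‖ ^ 2 ≤ (m + 2 : ℝ) * (4 * δ) ^ 2 := by
      rw [EuclideanSpace.norm_sq_eq]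
      calc ∑ i, ‖s i‖ ^ 2 ≤ ∑ _i : Fin (m + 2), (4 * δ) ^ 2 := Finset.sum_le_sum fun i _ => h4 i
        _ = _ := by simp
    have h6 : ρ = δ * (m + 22) := by rw [hδ]; field_simp
    refine (sq_le_sq₀ (norm_nonneg _) hρ.le).1 (h5.trans ?_)
    rw [h6]
    have : (0 : ℝ) ≤ m := by positivity
    nlinarith [mul_nonneg (sq_nonneg δ) (sq_nonneg (m : ℝ)), mul_nonneg (sq_nonneg δ) this,
      sq_nonneg δ]

theorem exists_poincare_sector {ρ : ℝ} (hρ : 0 < ρ) : ∃ η : ℝ, 0 < η ∧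
    ∀ β ∈ Ioo 0 (2 * Real.pi), ∀ Ω Γ : Set (EuclideanSpace ℝ (Fin (m + 2))), IsOpen Ω →
      Ω ⊆ sector (m + 2) β → Γ ⊆ frontier Ω ∩ frontier (sector (m + 2) β) →
      volume Ω < ENNReal.ofReal (η * β) →
      ∀ Φ : EuclideanSpace ℝ (Fin (m + 2)) → ℝ, ContDiff ℝ ∞ Φ →
        Disjoint (tsupport Φ) (frontier Ω \ Γ) →
        ∫⁻ x in Ω, ‖Φ x‖ₑ ^ 2 ≤
          4 * ENNReal.ofReal ρ ^ 2 * ∫⁻ x in Ω, ‖gradient Φ x‖ₑ ^ 2 := by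
  obtain ⟨η₁, hη₁, hbox⟩ := exists_box (m := m) hρ
  set V := volume (Metric.ball (0 : EuclideanSpace ℝ (Fin (m + 2))) (ρ / 2)) with hV
  have hV0 : V ≠ 0 := (Metric.measure_ball_pos _ _ (by positivity)).ne'
  have hVtop : V ≠ ⊤ := measure_ball_lt_top.ne
  have hVr : 0 < V.toReal := ENNReal.toReal_pos hV0 hVtop
  have hpi := Real.pi_pos
  -- The first bound gives `2|Ω| ≤ |K|` for `β ≤ π`; the second gives `2|Ω| ≤ V` for `β > π`, since
  -- `β < 2π`.
  refine ⟨min (η₁ / 2) (V.toReal / (4 * Real.pi)), lt_min (by positivity) (by positivity), ?_⟩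
  intro β hβ Ω Γ hΩ hΩs hΓ hvol Φ hΦ hdisj
  have hind : ∀ S : Set (EuclideanSpace ℝ (Fin (m + 2))), Ω ⊆ S →
      ∫⁻ x in Ω, ‖Φ x‖ₑ ^ 2 ≤ ∫⁻ x in S, ‖Ω.indicator Φ x‖ₑ ^ 2 := by
    intro S hS
    calc ∫⁻ x in Ω, ‖Φ x‖ₑ ^ 2 = ∫⁻ x in Ω, ‖Ω.indicator Φ x‖ₑ ^ 2 :=
          setLIntegral_congr_fun hΩ.measurableSet fun x hx => by simp [hx]
      _ ≤ _ := lintegral_mono_set hS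
  rcases le_or_gt β Real.pi with hβπ | hβπ
  · have hβ' : β ∈ Ioc 0 Real.pi := ⟨hβ.1, hβπ⟩
    obtain ⟨K, hKs, hKm, hKvol, hKρ⟩ := hbox β hβ'
    have hset : sector (m + 2) β = {x | 0 < inner ℝ (lowerNormal m) x} ∩
        {x | 0 < inner ℝ (upperNormal m β) x} := by
      ext x; exact mem_sector_of_le_pi hβ'
    have hopen : IsOpen (sector (m + 2) β) := by
      rw [hset]; exact (isOpen_halfSpace _).inter (isOpen_halfSpace _)
    have h2Ω : 2 * volume Ω ≤ volume K := by
      rw [hKvol]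
      calc 2 * volume Ω ≤ ENNReal.ofReal 2 * ENNReal.ofReal (η₁ / 2 * β) := by
            rw [ENNReal.ofReal_ofNat]
            gcongr
            refine hvol.le.trans (ENNReal.ofReal_le_ofReal ?_)
            exact mul_le_mul_of_nonneg_right (min_le_left _ _) hβ.1.le
        _ = _ := by rw [← ENNReal.ofReal_mul (by norm_num)]; congr 1; ring
    refine (hind _ hΩs).trans ((lintegral_sq_le_on_cone volume hopen ?_ hKs hKm ?_ ?_ hKρ hΩ h2Ω
      hΦ (notMem_frontier_inter_tsupport hopen subset_rfl hΓ hdisj)).trans ?_)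
    · intro x hx s hs t ht
      rw [mem_sector_of_le_pi hβ'] at hx hs ⊢
      exact ⟨inner_add_smul_pos hx.1 hs.1 ht, inner_add_smul_pos hx.2 hs.2 ht⟩
    · rw [hKvol]
      exact (ENNReal.ofReal_pos.2 (mul_pos hη₁ hβ.1)).ne'
    · rw [hKvol]; exact ENNReal.ofReal_ne_top
    · gcongr; norm_num
  · have hβ' : β ∈ Ioo Real.pi (2 * Real.pi) := ⟨hβπ, hβ.2⟩
    have h2Ω : 2 * volume Ω ≤ V := by
      calc 2 * volume Ω ≤ ENNReal.ofReal 2 * ENNReal.ofReal (V.toReal / (4 * Real.pi) * β) := by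
            rw [ENNReal.ofReal_ofNat]
            gcongr
            refine hvol.le.trans (ENNReal.ofReal_le_ofReal ?_)
            exact mul_le_mul_of_nonneg_right (min_le_right _ _) hβ.1.le
        _ ≤ ENNReal.ofReal V.toReal := by
          rw [← ENNReal.ofReal_mul (by norm_num)]
          refine ENNReal.ofReal_le_ofReal ?_
          rw [div_mul_eq_mul_div, mul_div_assoc', div_le_iff₀ (by positivity)]
          nlinarith [hβ.2]
        _ = V := ENNReal.ofReal_toReal hVtop
    -- The sector is no longer convex, but the estimate holds on each of the two half-spaces
    -- covering it; adding them turns `2ρ²` into `4ρ²`.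
    have key : ∀ ν : EuclideanSpace ℝ (Fin (m + 2)), ‖ν‖ = 1 →
        {x | 0 < inner ℝ ν x} ⊆ sector (m + 2) β → _ := fun ν hν hsub =>
      lintegral_sq_le_on_halfSpace volume hν hρ hΩ h2Ω hΦ
        (notMem_frontier_inter_tsupport (isOpen_halfSpace ν) hsub hΓ hdisj)
    calc ∫⁻ x in Ω, ‖Φ x‖ₑ ^ 2 ≤ ∫⁻ x in {x | 0 < inner ℝ (lowerNormal m) x} ∪
          {x | 0 < inner ℝ (upperNormal m β) x}, ‖Ω.indicator Φ x‖ₑ ^ 2 :=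
          hind _ fun x hx => (mem_sector_of_pi_lt hβ').1 (hΩs hx)
      _ ≤ _ := lintegral_union_le _ _ _
      _ ≤ _ := add_le_add
          (key _ norm_lowerNormal fun x hx => (mem_sector_of_pi_lt hβ').2 (Or.inl hx))
          (key _ (norm_upperNormal β) fun x hx => (mem_sector_of_pi_lt hβ').2 (Or.inr hx))
      _ = _ := by ring

end Sector

/-! ### Products of `L²`-convergent sequences -/

section L2

variable {α E : Type*} [MeasurableSpace α] {μ : Measure α} [NormedAddCommGroup E]
  [NormedSpace ℝ E]

theorem MeasureTheory.MemLp.integrable_smul_two {f : α → ℝ} {g : α → E} (hf : MemLp f 2 μ)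
    (hg : MemLp g 2 μ) : Integrable (fun x => f x • g x) μ :=
  memLp_one_iff_integrable.1 (hg.smul hf)

theorem tendsto_integral_smul_of_tendsto_eLpNorm {F : ℕ → α → ℝ} {f : α → ℝ} {G : ℕ → α → E}
    {g : α → E} (hF : ∀ k, MemLp (F k) 2 μ) (hf : MemLp f 2 μ) (hG : ∀ k, MemLp (G k) 2 μ)
    (hg : MemLp g 2 μ)
    (hFf : Tendsto (fun k => eLpNorm (fun x => F k x - f x) 2 μ) atTop (𝓝 0))
    (hGg : Tendsto (fun k => eLpNorm (fun x => G k x - g x) 2 μ) atTop (𝓝 0)) :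
    Tendsto (fun k => ∫ x, F k x • G k x ∂μ) atTop (𝓝 (∫ x, f x • g x ∂μ)) := by
  refine tendsto_integral_of_L1' _ (hf.integrable_smul_two hg).1
    (Eventually.of_forall fun k => (hF k).integrable_smul_two (hG k)) ?_
  have hlim : Tendsto (fun k => eLpNorm (fun x => F k x - f x) 2 μ *
      (eLpNorm (fun x => G k x - g x) 2 μ + eLpNorm g 2 μ) +
      eLpNorm f 2 μ * eLpNorm (fun x => G k x - g x) 2 μ) atTop (𝓝 0) := by
    have h1 := ENNReal.Tendsto.mul hFf (Or.inr (by simpa using hg.2.ne))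
      (hGg.add_const (eLpNorm g 2 μ)) (Or.inr ENNReal.zero_ne_top)
    have h2 := ENNReal.Tendsto.const_mul (a := eLpNorm f 2 μ) hGg (Or.inr hf.2.ne)
    simpa using h1.add h2
  refine tendsto_of_tendsto_of_tendsto_of_le_of_le tendsto_const_nhds hlim
    (fun _ => zero_le) fun k => ?_
  have hsub1 : AEStronglyMeasurable (fun x => F k x - f x) μ := (hF k).1.sub hf.1
  have hsub2 : AEStronglyMeasurable (fun x => G k x - g x) μ := (hG k).1.sub hg.1
  -- `FG - fg = (F - f)G + f(G - g)`, with each term controlled by Hölder.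
  have hsplit : ((fun x => F k x • G k x) - fun x => f x • g x) =
      (fun x => F k x - f x) • G k + f • fun x => G k x - g x := by
    ext x
    simp only [Pi.sub_apply, Pi.add_apply, Pi.smul_apply', sub_smul, smul_sub]
    abel
  have hGk : eLpNorm (G k) 2 μ ≤ eLpNorm (fun x => G k x - g x) 2 μ + eLpNorm g 2 μ := by
    have : G k = (fun x => G k x - g x) + g := by ext x; simp
    conv_lhs => rw [this]
    exact eLpNorm_add_le hsub2 hg.1 (by norm_num)
  rw [hsplit]
  refine (eLpNorm_add_le (hsub1.smul (hG k).1) (hf.1.smul hsub2) le_rfl).trans ?_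
  gcongr
  · refine (eLpNorm_smul_le_mul_eLpNorm (p := 2) (q := 2) (hG k).1 hsub1).trans ?_
    gcongr
  · exact eLpNorm_smul_le_mul_eLpNorm (p := 2) (q := 2) hsub2 hf.1

end L2

/-! ### Integration by parts for smooth functions -/

section Gradient

variable {E : Type*} [NormedAddCommGroup E] [InnerProductSpace ℝ E] [CompleteSpace E]

theorem tsupport_gradient_subset (ψ : E → ℝ) : tsupport (gradient ψ) ⊆ tsupport ψ := by
  refine closure_minimal (fun x hx => ?_) (isClosed_tsupport ψ)
  by_contra h
  refine hx ?_
  rw [(notMem_tsupport_iff_eventuallyEq.1 h).gradient_eq]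
  exact gradient_fun_const x 0

theorem HasCompactSupport.gradient {ψ : E → ℝ} (hψ : HasCompactSupport ψ) :
    HasCompactSupport (gradient ψ) :=
  hψ.mono' ((subset_tsupport _).trans (tsupport_gradient_subset ψ))

theorem gradient_mul {f g : E → ℝ} {x : E} (hf : DifferentiableAt ℝ f x)
    (hg : DifferentiableAt ℝ g x) :
    gradient (fun y => f y * g y) x = f x • gradient g x + g x • gradient f x := by
  refine ext_inner_right ℝ fun v => ?_
  rw [inner_gradient_left, inner_add_left, inner_smul_left, inner_smul_left,
    inner_gradient_left, inner_gradient_left]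
  have h := congrArg (fun L => L v) (hf.hasFDerivAt.mul hg.hasFDerivAt).fderiv
  change fderiv ℝ (f * g) x v = _
  simpa using h

theorem gradient_comp_real {F : ℝ → ℝ} {F' : ℝ} {f : E → ℝ} {x : E} (hf : DifferentiableAt ℝ f x)
    (hF : HasDerivAt F F' (f x)) :
    gradient (fun y => F (f y)) x = F' • gradient f x := by
  refine ext_inner_right ℝ fun v => ?_
  rw [inner_gradient_left, inner_smul_left, inner_gradient_left]
  have h := congrArg (fun L => L v) (hF.comp_hasFDerivAt x hf.hasFDerivAt).fderiv
  change fderiv ℝ (F ∘ f) x v = _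
  simpa using h

variable [MeasurableSpace E] [BorelSpace E]

theorem ContDiff.memLp_gradient {ψ : E → ℝ} (hψ : ContDiff ℝ ∞ ψ) (hc : HasCompactSupport ψ)
    (p : ENNReal) (ν : Measure E) [IsFiniteMeasureOnCompacts ν] : MemLp (gradient ψ) p ν :=
  hψ.continuous_gradient.memLp_of_hasCompactSupport hc.gradient

variable [FiniteDimensional ℝ E] {μ : Measure E}

theorem integral_smul_gradient_eq_neg [μ.IsAddHaarMeasure] {h ψ : E → ℝ} (hh : ContDiff ℝ ∞ h)
    (hψ : ContDiff ℝ ∞ ψ) (hc : HasCompactSupport ψ) :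
    ∫ x, h x • gradient ψ x ∂μ = -∫ x, ψ x • gradient h x ∂μ := by
  have i1 : Integrable (fun x => h x • gradient ψ x) μ :=
    (hh.continuous.smul hψ.continuous_gradient).integrable_of_hasCompactSupport
      (hc.gradient.smul_left)
  have i2 : Integrable (fun x => ψ x • gradient h x) μ :=
    (hψ.continuous.smul hh.continuous_gradient).integrable_of_hasCompactSupport
      (hc.smul_right)
  refine ext_inner_left ℝ fun v => ?_
  rw [inner_neg_right, ← integral_inner i1, ← integral_inner i2]
  have j1 := i1.const_inner (𝕜 := ℝ) v
  have j2 := i2.const_inner (𝕜 := ℝ) v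
  simp only [inner_smul_right, inner_gradient_right, conj_trivial] at j1 j2 ⊢
  have := integral_mul_fderiv_eq_neg_fderiv_mul_of_integrable (μ := μ) (f := h) (g := ψ) (v := v)
    (by simpa only [mul_comm] using j2) j1
    ((hh.continuous.mul hψ.continuous).integrable_of_hasCompactSupport hc.mul_left)
    (fun x _ => hh.differentiable (by simp) x) (fun x _ => hψ.differentiable (by simp) x)
  rw [this]
  simp only [mul_comm]

theorem ae_restrict_eq_zero_of_integral_contDiff_smul {Ω : Set E} (hΩ : IsOpen Ω) {h : E → E}
    (hh : LocallyIntegrableOn h Ω μ)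
    (H : ∀ ψ : E → ℝ, ContDiff ℝ ∞ ψ → HasCompactSupport ψ → tsupport ψ ⊆ Ω →
      ∫ x in Ω, ψ x • h x ∂μ = 0) : ∀ᵐ x ∂μ.restrict Ω, h x = 0 := by
  rw [ae_restrict_iff' hΩ.measurableSet]
  refine hΩ.ae_eq_zero_of_integral_contDiff_smul_eq_zero hh fun ψ h1 h2 h3 => ?_
  rw [← H ψ h1 h2 h3]
  refine (setIntegral_eq_integral_of_forall_compl_eq_zero fun x hx => ?_).symm
  rw [image_eq_zero_of_notMem_tsupport fun h => hx (h3 h), zero_smul]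

end Gradient

/-! ### Weak chain and product rules -/

section Weak

variable {n : ℕ} {Ω Γ : Set (EuclideanSpace ℝ (Fin n))}
  {u f ψ : EuclideanSpace ℝ (Fin n) → ℝ}
  {Du Df : EuclideanSpace ℝ (Fin n) → EuclideanSpace ℝ (Fin n)}

theorem setIntegral_smul_gradient_eq_neg (hψ : ContDiff ℝ ∞ ψ) (hc : HasCompactSupport ψ)
    (hs : tsupport ψ ⊆ Ω) {h : EuclideanSpace ℝ (Fin n) → ℝ} (hh : ContDiff ℝ ∞ h) :
    ∫ x in Ω, h x • gradient ψ x = -∫ x in Ω, ψ x • gradient h x := by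
  rw [setIntegral_eq_integral_of_forall_compl_eq_zero,
    setIntegral_eq_integral_of_forall_compl_eq_zero]
  · exact integral_smul_gradient_eq_neg hh hψ hc
  · intro x hx
    rw [image_eq_zero_of_notMem_tsupport fun h => hx (hs h), zero_smul]
  · intro x hx
    rw [image_eq_zero_of_notMem_tsupport fun h => hx (hs (tsupport_gradient_subset ψ h)),
      smul_zero]

theorem MeasureTheory.MemLp.mul_bounded {α : Type*} [MeasurableSpace α] {μ : Measure α}
    {φ b : α → ℝ} {M : ℝ} (hφ : MemLp φ 2 μ) (hb : AEStronglyMeasurable b μ)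
    (hM : ∀ x, |b x| ≤ M) : MemLp (fun x => φ x * b x) 2 μ := by
  refine MemLp.of_le_mul (c := M) hφ (hφ.1.mul hb) (Eventually.of_forall fun x => ?_)
  rw [norm_mul, mul_comm]
  exact mul_le_mul_of_nonneg_right (hM x) (norm_nonneg _)

theorem MeasureTheory.MemLp.bounded_smul {α E : Type*} [MeasurableSpace α] {μ : Measure α}
    [NormedAddCommGroup E] [NormedSpace ℝ E] {φ : α → E} {b : α → ℝ} {M : ℝ} (hφ : MemLp φ 2 μ)
    (hb : AEStronglyMeasurable b μ) (hM : ∀ x, |b x| ≤ M) : MemLp (fun x => b x • φ x) 2 μ := by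
  refine MemLp.of_le_mul (c := M) hφ (hb.smul hφ.1) (Eventually.of_forall fun x => ?_)
  rw [norm_smul]
  exact mul_le_mul_of_nonneg_right (hM x) (norm_nonneg _)

theorem exists_abs_le_of_hasCompactSupport (hψ : ContDiff ℝ ∞ ψ) (hc : HasCompactSupport ψ) :
    ∃ M : NNReal, ∀ x, |ψ x| ≤ M := by
  obtain ⟨M, hM⟩ := hc.exists_bound_of_continuous hψ.continuous
  exact ⟨M.toNNReal, fun x => (hM x).trans (Real.le_coe_toNNReal M)⟩

/-- Weak chain rule for functions that are limits of test functions. -/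
theorem IsSobolevH10.integral_comp_smul_gradient (hf : IsSobolevH10 Ω Γ f Df) {F F' : ℝ → ℝ}
    (hF : ContDiff ℝ ∞ F) (hF' : ∀ t, HasDerivAt F (F' t) t) {K K' : NNReal}
    (hK : LipschitzWith K F) (hF0 : F 0 = 0) (hK' : LipschitzWith K' F') {M : ℝ}
    (hM : ∀ t, |F' t| ≤ M)
    (hψ : ContDiff ℝ ∞ ψ) (hc : HasCompactSupport ψ) (hs : tsupport ψ ⊆ Ω) :
    ∫ x in Ω, F (f x) • gradient ψ x = -∫ x in Ω, (ψ x * F' (f x)) • Df x := by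
  obtain ⟨Φ, hΦ, hlim, hlim'⟩ := hf.approx
  obtain ⟨C, hC⟩ := exists_abs_le_of_hasCompactSupport hψ hc
  have hψ2 : MemLp ψ 2 (volume.restrict Ω) := hψ.continuous.memLp_of_hasCompactSupport hc
  have hΦ2 : ∀ k, MemLp (Φ k) 2 (volume.restrict Ω) := fun k =>
    (hΦ k).1.continuous.memLp_of_hasCompactSupport (hΦ k).2.1
  have hscale : ∀ {G : ℕ → EuclideanSpace ℝ (Fin n) → ℝ} (c : NNReal),
      (∀ k x, |G k x| ≤ c * |Φ k x - f x|) →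
      Tendsto (fun k => eLpNorm (G k) 2 (volume.restrict Ω)) atTop (𝓝 0) := by
    intro G c hG
    have h1 := ENNReal.Tendsto.const_mul (a := (c : ENNReal)) hlim (Or.inr ENNReal.coe_ne_top)
    rw [mul_zero] at h1
    exact tendsto_of_tendsto_of_tendsto_of_le_of_le tendsto_const_nhds h1 (fun _ => zero_le)
      fun k => eLpNorm_le_nnreal_smul_eLpNorm_of_ae_le_mul
        (Eventually.of_forall fun x => hG k x) 2
  have hL : Tendsto (fun k => ∫ x in Ω, F (Φ k x) • gradient ψ x) atTop
      (𝓝 (∫ x in Ω, F (f x) • gradient ψ x)) := by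
    refine tendsto_integral_smul_of_tendsto_eLpNorm (fun k => hK.comp_memLp hF0 (hΦ2 k))
      (hK.comp_memLp hF0 hf.sobolev.memLp) (fun _ => hψ.memLp_gradient hc 2 _)
      (hψ.memLp_gradient hc 2 _) ?_ (by simp)
    refine hscale K fun k x => ?_
    simpa [Real.dist_eq] using hK.dist_le_mul (Φ k x) (f x)
  have hR : Tendsto (fun k => ∫ x in Ω, (ψ x * F' (Φ k x)) • gradient (Φ k) x) atTop
      (𝓝 (∫ x in Ω, (ψ x * F' (f x)) • Df x)) := by
    refine tendsto_integral_smul_of_tendsto_eLpNorm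
      (fun k => hψ2.mul_bounded
        (hK'.continuous.comp_aestronglyMeasurable (hΦ2 k).1) fun x => hM _)
      (hψ2.mul_bounded
        (hK'.continuous.comp_aestronglyMeasurable hf.sobolev.memLp.1) fun x => hM _)
      (fun k => (hΦ k).1.memLp_gradient (hΦ k).2.1 2 _) hf.sobolev.memLp_grad ?_ hlim'
    refine hscale (C * K') fun k x => ?_
    rw [← mul_sub, abs_mul, NNReal.coe_mul, mul_assoc]
    refine mul_le_mul (hC x) ?_ (abs_nonneg _) C.2
    simpa [Real.dist_eq] using hK'.dist_le_mul (Φ k x) (f x)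
  refine tendsto_nhds_unique hL (hR.neg.congr fun k => ?_)
  rw [setIntegral_smul_gradient_eq_neg (h := fun x => F (Φ k x)) hψ hc hs (hF.comp (hΦ k).1)]
  congr 1
  refine integral_congr_ae (Eventually.of_forall fun x => ?_)
  dsimp only
  rw [gradient_comp_real ((hΦ k).1.differentiable (by simp) x) (hF' _), smul_smul]

/-- Weak product rule, when one factor is a limit of test functions. -/
theorem IsSobolevH10.integral_mul (hf : IsSobolevH10 Ω Γ f Df) (hu : IsSobolevW12 Ω u Du)
    (hψ : ContDiff ℝ ∞ ψ) (hc : HasCompactSupport ψ) (hs : tsupport ψ ⊆ Ω) :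
    ∫ x in Ω, (f x * u x) • gradient ψ x = -∫ x in Ω, ψ x • (f x • Du x + u x • Df x) := by
  obtain ⟨Φ, hΦ, hlim, hlim'⟩ := hf.approx
  obtain ⟨C, hC⟩ := exists_abs_le_of_hasCompactSupport hψ hc
  obtain ⟨C', hC'⟩ := hc.gradient.exists_bound_of_continuous hψ.continuous_gradient
  have hψm : AEStronglyMeasurable ψ (volume.restrict Ω) := hψ.continuous.aestronglyMeasurable
  have hΦ2 : ∀ k, MemLp (Φ k) 2 (volume.restrict Ω) := fun k =>
    (hΦ k).1.continuous.memLp_of_hasCompactSupport (hΦ k).2.1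
  have hΦg : ∀ k, MemLp (gradient (Φ k)) 2 (volume.restrict Ω) := fun k =>
    (hΦ k).1.memLp_gradient (hΦ k).2.1 2 _
  have hψDu : MemLp (fun x => ψ x • Du x) 2 (volume.restrict Ω) :=
    hu.memLp_grad.bounded_smul hψm hC
  have hψu : MemLp (fun x => ψ x * u x) 2 (volume.restrict Ω) :=
    hu.memLp.bounded_smul hψm hC
  have huψ : MemLp (fun x => u x • gradient ψ x) 2 (volume.restrict Ω) := by
    refine MemLp.of_le_mul (c := C') hu.memLp
      (hu.memLp.1.smul hψ.continuous_gradient.aestronglyMeasurable)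
      (Eventually.of_forall fun x => ?_)
    rw [norm_smul, mul_comm]
    exact mul_le_mul_of_nonneg_right (hC' x) (norm_nonneg _)
  have h1 := tendsto_integral_smul_of_tendsto_eLpNorm hΦ2 hf.sobolev.memLp (fun _ => huψ) huψ
    hlim (by simp)
  have h2 := tendsto_integral_smul_of_tendsto_eLpNorm hΦ2 hf.sobolev.memLp (fun _ => hψDu) hψDu
    hlim (by simp)
  have h3 := tendsto_integral_smul_of_tendsto_eLpNorm (fun _ => hψu) hψu hΦg
    hf.sobolev.memLp_grad (by simp) hlim'
  have hk : ∀ k, ∫ x in Ω, Φ k x • u x • gradient ψ x =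
      -((∫ x in Ω, Φ k x • ψ x • Du x) + ∫ x in Ω, (ψ x * u x) • gradient (Φ k) x) := by
    intro k
    -- `ψ Φ_k` is an admissible test function because `ψ` is supported in `Ω`, even if `Φ_k` is not.
    have hw := hu.weak_grad (fun x => ψ x * Φ k x) (hψ.mul (hΦ k).1) hc.mul_right
      ((tsupport_mul_subset_left).trans hs)
    have e1 : ∀ x, u x • gradient (fun x => ψ x * Φ k x) x =
        (ψ x * u x) • gradient (Φ k) x + Φ k x • u x • gradient ψ x := by
      intro x
      rw [gradient_mul (hψ.differentiable (by simp) x) ((hΦ k).1.differentiable (by simp) x),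
        smul_add, smul_smul, smul_smul, smul_smul, mul_comm (u x), mul_comm (u x)]
    have e2 : ∀ x, (ψ x * Φ k x) • Du x = Φ k x • ψ x • Du x := by
      intro x; rw [smul_smul, mul_comm]
    simp only [e1, e2] at hw
    rw [integral_add (hψu.integrable_smul_two (hΦg k)) ((hΦ2 k).integrable_smul_two huψ)] at hw
    rw [neg_add, ← hw]
    abel
  have key := tendsto_nhds_unique h1 ((h2.add h3).neg.congr fun k => (hk k).symm)
  rw [← integral_add (hf.sobolev.memLp.integrable_smul_two hψDu)
    (hψu.integrable_smul_two hf.sobolev.memLp_grad)] at key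
  calc ∫ x in Ω, (f x * u x) • gradient ψ x = ∫ x in Ω, f x • u x • gradient ψ x := by
        simp only [smul_smul]
    _ = _ := key
    _ = _ := by
      congr 1
      refine integral_congr_ae (Eventually.of_forall fun x => ?_)
      simp only [smul_add, smul_smul, mul_comm]

theorem IsSobolevH10.product_rule_of_mul_eq_zero (hΩ : IsOpen Ω) (hf : IsSobolevH10 Ω Γ f Df)
    (hu : IsSobolevW12 Ω u Du) (hfu : ∀ x, f x * u x = 0) :
    ∀ᵐ x ∂volume.restrict Ω, f x • Du x + u x • Df x = 0 := by
  refine ae_restrict_eq_zero_of_integral_contDiff_smul hΩ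
    (IntegrableOn.locallyIntegrableOn ((hf.sobolev.memLp.integrable_smul_two hu.memLp_grad).add
      (hu.memLp.integrable_smul_two hf.sobolev.memLp_grad))) fun ψ h1 h2 h3 => ?_
  have h := hf.integral_mul hu h1 h2 h3
  simp only [hfu, zero_smul, integral_zero] at h
  exact neg_eq_zero.1 h.symm

theorem lipschitzWith_arctan_mul (l : NNReal) : LipschitzWith l fun t => Real.arctan (l * t) := by
  have h : ∀ t : ℝ,
      HasDerivAt (fun t => Real.arctan (l * t)) (1 / (1 + (l * t) ^ 2) * l) t := fun t => by
    simpa using ((hasDerivAt_id t).const_mul (l : ℝ)).arctan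
  refine lipschitzWith_of_nnnorm_deriv_le (fun t => (h t).differentiableAt) fun t => ?_
  rw [(h t).deriv, ← NNReal.coe_le_coe, coe_nnnorm, norm_mul, NNReal.norm_eq]
  refine mul_le_of_le_one_left l.2 ?_
  rw [Real.norm_of_nonneg (by positivity), div_le_one (by positivity)]
  nlinarith [sq_nonneg (l * t : ℝ)]

theorem lipschitzWith_inv_one_add_sq : LipschitzWith 1 fun t : ℝ => (1 + t ^ 2)⁻¹ := by
  refine LipschitzWith.of_dist_le_mul fun a b => ?_
  have e : (1 + a ^ 2)⁻¹ - (1 + b ^ 2)⁻¹ = (b - a) * ((b + a) / ((1 + a ^ 2) * (1 + b ^ 2))) := by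
    field_simp
    ring
  rw [Real.dist_eq, Real.dist_eq, e, abs_mul, abs_sub_comm b a, NNReal.coe_one, one_mul]
  refine mul_le_of_le_one_right (abs_nonneg _) ?_
  rw [abs_div, abs_of_pos (show 0 < (1 + a ^ 2) * (1 + b ^ 2) by positivity),
    div_le_one (by positivity), abs_le]
  constructor <;>
    nlinarith [sq_nonneg (a + 1), sq_nonneg (b + 1), sq_nonneg (a - 1), sq_nonneg (b - 1),
      sq_nonneg (a * b)]

/-- The weak gradient of a limit of test functions vanishes almost everywhere on its zero set. -/
theorem IsSobolevH10.grad_eq_zero_of_eq_zero (hΩ : IsOpen Ω) (hf : IsSobolevH10 Ω Γ f Df) :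
    ∀ᵐ x ∂volume.restrict Ω, f x = 0 → Df x = 0 := by
  have hfm := hf.sobolev.memLp.1
  have hDm := hf.sobolev.memLp_grad.1
  -- With `l = k + 1`, `b k` is the derivative of `arctan (l t) / l` at `f`. These functions tend to
  -- `0` uniformly, while their derivatives stay bounded and tend to the indicator of the zero set.
  -- The chain rule in the limit gives `∫ ψ 1_{f=0} Df = 0`.
  set b : ℕ → EuclideanSpace ℝ (Fin n) → ℝ := fun k x => (1 + ((k + 1 : ℝ) * f x) ^ 2)⁻¹ with hb
  have hbm : ∀ k, AEStronglyMeasurable (b k) (volume.restrict Ω) := fun k =>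
    (lipschitzWith_inv_one_add_sq.continuous.comp
      (continuous_const.mul continuous_id)).comp_aestronglyMeasurable hfm
  have hb1 : ∀ k x, |b k x| ≤ 1 := fun k x => by
    rw [abs_of_pos (by positivity)]
    exact inv_le_one_of_one_le₀ (by nlinarith [sq_nonneg ((k + 1 : ℝ) * f x)])
  have hk1 : Tendsto (fun k : ℕ => (k + 1 : ℝ)) atTop atTop :=
    tendsto_atTop_add_const_right _ _ tendsto_natCast_atTop_atTop
  have hblim : ∀ x, Tendsto (fun k => b k x) atTop (𝓝 (if f x = 0 then 1 else 0)) := by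
    intro x
    split_ifs with h
    · simp [hb, h]
    · refine tendsto_inv_atTop_zero.comp (tendsto_atTop_add_const_left _ _ ?_)
      simp only [mul_pow]
      exact ((tendsto_pow_atTop two_ne_zero).comp hk1).atTop_mul_const (by positivity)
  have hlimm : AEStronglyMeasurable (fun x => if f x = 0 then (1 : ℝ) else 0)
      (volume.restrict Ω) :=
    aestronglyMeasurable_of_tendsto_ae atTop hbm (Eventually.of_forall hblim)
  have hL2 : MemLp (fun x => (if f x = 0 then (1 : ℝ) else 0) • Df x) 2 (volume.restrict Ω) :=
    hf.sobolev.memLp_grad.bounded_smul (M := 1) hlimm fun x => by split_ifs <;> simp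
  have hloc : ∀ k : ℕ, ∀ φ : EuclideanSpace ℝ (Fin n) → ℝ, ContDiff ℝ ∞ φ → HasCompactSupport φ →
      tsupport φ ⊆ Ω → ∫ x in Ω, ((k + 1 : ℝ)⁻¹ * Real.arctan ((k + 1) * f x)) • gradient φ x =
        -∫ x in Ω, (φ x * b k x) • Df x := by
    intro k φ h1 h2 h3
    set l : NNReal := k + 1 with hl
    have hlc : (l : ℝ) = k + 1 := by simp [hl]
    have hl0 : (l : ℝ) ≠ 0 := by rw [hlc]; positivity
    have h := hf.integral_comp_smul_gradient (F := fun t => Real.arctan (l * t))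
      (F' := fun t => l * (1 + (l * t) ^ 2)⁻¹) (K := l) (K' := l * (1 * l)) (M := l)
      (Real.contDiff_arctan.comp (contDiff_const.mul contDiff_id)) ?_
      (lipschitzWith_arctan_mul l) (by simp) ?_ ?_ h1 h2 h3
    · have h' := congrArg (fun z => (l : ℝ)⁻¹ • z) h
      simp only [smul_neg, ← integral_smul, smul_smul] at h'
      simp only [hb, ← hlc]
      rw [h']
      congr 1
      refine integral_congr_ae (Eventually.of_forall fun x => ?_)
      simp only
      congr 1
      field_simp
    · intro t
      simpa [mul_comm] using ((hasDerivAt_id t).const_mul (l : ℝ)).arctan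
    · have hm : ∀ c : NNReal, LipschitzWith c fun t : ℝ => (c : ℝ) * t := fun c =>
        LipschitzWith.of_dist_le_mul fun x y => by
          rw [Real.dist_eq, Real.dist_eq, ← mul_sub, abs_mul, NNReal.abs_eq]
      exact (hm l).comp (lipschitzWith_inv_one_add_sq.comp (hm l))
    · intro t
      rw [abs_of_nonneg (by positivity)]
      exact mul_le_of_le_one_right l.2
        (inv_le_one_of_one_le₀ (by nlinarith [sq_nonneg ((l : ℝ) * t)]))
  have hzero : ∀ φ : EuclideanSpace ℝ (Fin n) → ℝ, ContDiff ℝ ∞ φ → HasCompactSupport φ →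
      tsupport φ ⊆ Ω → ∫ x in Ω, φ x • (if f x = 0 then (1 : ℝ) else 0) • Df x = 0 := by
    intro φ h1 h2 h3
    have hφ2 : MemLp φ 2 (volume.restrict Ω) := h1.continuous.memLp_of_hasCompactSupport h2
    have hφg : Integrable (gradient φ) (volume.restrict Ω) :=
      h1.continuous_gradient.integrable_of_hasCompactSupport h2.gradient
    have hR : Tendsto (fun k => ∫ x in Ω, (φ x * b k x) • Df x) atTop
        (𝓝 (∫ x in Ω, φ x • (if f x = 0 then (1 : ℝ) else 0) • Df x)) := by
      refine tendsto_integral_of_dominated_convergence (fun x => ‖φ x • Df x‖)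
        (fun k => (hφ2.1.mul (hbm k)).smul hDm)
        (hφ2.integrable_smul_two hf.sobolev.memLp_grad).norm
        (fun k => Eventually.of_forall fun x => ?_) (Eventually.of_forall fun x => ?_)
      · rw [norm_smul, norm_smul, norm_mul]
        gcongr
        exact mul_le_of_le_one_right (norm_nonneg _) (hb1 k x)
      · rw [smul_smul]
        exact ((hblim x).const_mul (φ x)).smul_const (Df x)
    have hL : Tendsto (fun k : ℕ => ∫ x in Ω,
        ((k + 1 : ℝ)⁻¹ * Real.arctan ((k + 1) * f x)) • gradient φ x) atTop (𝓝 0) := by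
      refine squeeze_zero_norm (a := fun k : ℕ =>
        (k + 1 : ℝ)⁻¹ * (Real.pi / 2 * ∫ x in Ω, ‖gradient φ x‖)) (fun k => ?_) ?_
      · rw [← mul_assoc, ← integral_const_mul]
        refine norm_integral_le_of_norm_le (hφg.norm.const_mul _)
          (Eventually.of_forall fun x => ?_)
        rw [norm_smul, norm_mul, Real.norm_of_nonneg (by positivity : (0 : ℝ) ≤ (k + 1 : ℝ)⁻¹)]
        gcongr
        exact abs_le.2 ⟨(Real.neg_pi_div_two_lt_arctan _).le, (Real.arctan_lt_pi_div_two _).le⟩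
      · simpa using (tendsto_inv_atTop_zero.comp hk1).mul_const
          (Real.pi / 2 * ∫ x in Ω, ‖gradient φ x‖)
    have := tendsto_nhds_unique hL (hR.neg.congr fun k => (hloc k φ h1 h2 h3).symm)
    exact neg_eq_zero.1 this.symm
  have hcut : ∀ᵐ x ∂volume.restrict Ω, (if f x = 0 then (1 : ℝ) else 0) • Df x = 0 := by
    -- `Ω` may have infinite measure, so the `L²` field is only locally integrable, which suffices.
    refine ae_restrict_eq_zero_of_integral_contDiff_smul hΩ (fun x hx => ?_) hzero
    obtain ⟨r, hr, hball⟩ := Metric.nhds_basis_closedBall.mem_iff.1 (hΩ.mem_nhds hx)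
    refine ⟨Metric.closedBall x r, mem_nhdsWithin_of_mem_nhds (Metric.closedBall_mem_nhds x hr),
      ?_⟩
    have : IsFiniteMeasure (volume.restrict (Metric.closedBall x r)) :=
      ⟨by simpa using measure_closedBall_lt_top⟩
    exact (hL2.mono_measure (Measure.restrict_mono hball le_rfl)).integrable (by norm_num)
  filter_upwards [hcut] with x hx h0
  simpa [h0] using hx

end Weak

/-! ### Passage to `H¹₀` and the gradient of the positive part -/

theorem eLpNorm_two_sq_eq_lintegral {α E : Type*} [MeasurableSpace α] {μ : Measure α}
    [NormedAddCommGroup E] (f : α → E) : eLpNorm f 2 μ ^ 2 = ∫⁻ x, ‖f x‖ₑ ^ 2 ∂μ := by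
  rw [eLpNorm_eq_lintegral_rpow_enorm_toReal two_ne_zero ENNReal.ofNat_ne_top,
    ← ENNReal.rpow_natCast, ← ENNReal.rpow_mul]
  simp

theorem MeasureTheory.MemLp.integral_norm_sq_eq {α E : Type*} [MeasurableSpace α] {μ : Measure α}
    [NormedAddCommGroup E] {f : α → E} (hf : MemLp f 2 μ) :
    ∫ x, ‖f x‖ ^ 2 ∂μ = (eLpNorm f 2 μ).toReal ^ 2 := by
  rw [← ENNReal.toReal_pow, eLpNorm_two_sq_eq_lintegral,
    integral_eq_lintegral_of_nonneg_ae (Eventually.of_forall fun x => sq_nonneg _)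
      (hf.1.norm.pow 2)]
  congr 1
  refine lintegral_congr fun x => ?_
  rw [ENNReal.ofReal_pow (norm_nonneg _), ofReal_norm]

section Sobolev

variable {n : ℕ} {Ω Γ : Set (EuclideanSpace ℝ (Fin n))}
  {u v f : EuclideanSpace ℝ (Fin n) → ℝ}
  {Du Dv Df : EuclideanSpace ℝ (Fin n) → EuclideanSpace ℝ (Fin n)}

/-- An `L²` bound by the gradient extends from test functions to their limits. -/
theorem IsSobolevH10.integral_sq_le (hf : IsSobolevH10 Ω Γ f Df) {R : ℝ} (hR : 0 ≤ R)
    (H : ∀ Φ : EuclideanSpace ℝ (Fin n) → ℝ, ContDiff ℝ ∞ Φ →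
      Disjoint (tsupport Φ) (frontier Ω \ Γ) →
      ∫⁻ x in Ω, ‖Φ x‖ₑ ^ 2 ≤ ENNReal.ofReal R ^ 2 * ∫⁻ x in Ω, ‖gradient Φ x‖ₑ ^ 2) :
    ∫ x in Ω, ‖f x‖ ^ 2 ≤ R ^ 2 * ∫ x in Ω, ‖Df x‖ ^ 2 := by
  obtain ⟨Φ, hΦ, hlim, hlim'⟩ := hf.approx
  have hfm := hf.sobolev.memLp
  have hDm := hf.sobolev.memLp_grad
  have hk : ∀ k, eLpNorm f 2 (volume.restrict Ω) ≤
      eLpNorm (fun x => Φ k x - f x) 2 (volume.restrict Ω) + ENNReal.ofReal R *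
        (eLpNorm (fun x => gradient (Φ k) x - Df x) 2 (volume.restrict Ω) +
          eLpNorm Df 2 (volume.restrict Ω)) := by
    intro k
    have hΦm : AEStronglyMeasurable (Φ k) (volume.restrict Ω) :=
      (hΦ k).1.continuous.aestronglyMeasurable
    have hΦg : AEStronglyMeasurable (gradient (Φ k)) (volume.restrict Ω) :=
      (hΦ k).1.continuous_gradient.aestronglyMeasurable
    have h1 : eLpNorm (Φ k) 2 (volume.restrict Ω) ≤
        ENNReal.ofReal R * eLpNorm (gradient (Φ k)) 2 (volume.restrict Ω) := by
      refine (ENNReal.pow_le_pow_left_iff two_ne_zero).1 ?_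
      rw [mul_pow, eLpNorm_two_sq_eq_lintegral, eLpNorm_two_sq_eq_lintegral]
      exact H (Φ k) (hΦ k).1 (hΦ k).2.2
    have e1 : f = Φ k - fun x => Φ k x - f x := by ext x; simp
    have e2 : gradient (Φ k) = (fun x => gradient (Φ k) x - Df x) + Df := by ext x; simp
    have h2 : eLpNorm f 2 (volume.restrict Ω) ≤ eLpNorm (Φ k) 2 (volume.restrict Ω) +
        eLpNorm (fun x => Φ k x - f x) 2 (volume.restrict Ω) := by
      conv_lhs => rw [e1]
      exact eLpNorm_sub_le hΦm (hΦm.sub hfm.1) (by norm_num)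
    have h3 : eLpNorm (gradient (Φ k)) 2 (volume.restrict Ω) ≤
        eLpNorm (fun x => gradient (Φ k) x - Df x) 2 (volume.restrict Ω) +
          eLpNorm Df 2 (volume.restrict Ω) := by
      conv_lhs => rw [e2]
      exact eLpNorm_add_le (hΦg.sub hDm.1) hDm.1 (by norm_num)
    refine h2.trans ?_
    rw [add_comm]
    gcongr
    exact h1.trans (by gcongr)
  have hT := hlim.add (ENNReal.Tendsto.const_mul (a := ENNReal.ofReal R)
    (hlim'.add_const (eLpNorm Df 2 (volume.restrict Ω))) (Or.inr ENNReal.ofReal_ne_top))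
  rw [zero_add, zero_add] at hT
  have h := ge_of_tendsto' hT hk
  rw [hfm.integral_norm_sq_eq, hDm.integral_norm_sq_eq, ← mul_pow]
  gcongr
  have h' := ENNReal.toReal_mono (ENNReal.mul_ne_top ENNReal.ofReal_ne_top hDm.2.ne) h
  rwa [ENNReal.toReal_mul, ENNReal.toReal_ofReal hR] at h'

theorem IsSobolevW12.sub (hu : IsSobolevW12 Ω u Du) (hv : IsSobolevW12 Ω v Dv) :
    IsSobolevW12 Ω (fun x => u x - v x) (fun x => Du x - Dv x) where
  memLp := hu.memLp.sub hv.memLp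
  memLp_grad := hu.memLp_grad.sub hv.memLp_grad
  weak_grad ψ h1 h2 h3 := by
    have hψ : MemLp ψ 2 (volume.restrict Ω) := h1.continuous.memLp_of_hasCompactSupport h2
    have hψg := h1.memLp_gradient h2 2 (volume.restrict Ω)
    simp only [sub_smul, smul_sub]
    rw [integral_sub (hu.memLp.integrable_smul_two hψg) (hv.memLp.integrable_smul_two hψg),
      integral_sub (hψ.integrable_smul_two hu.memLp_grad) (hψ.integrable_smul_two hv.memLp_grad),
      hu.weak_grad ψ h1 h2 h3, hv.weak_grad ψ h1 h2 h3]
    abel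

/-- The weak gradient of `w⁺` is orthogonal to that of `w⁻`. -/
theorem IsSobolevH10.inner_grad_posPart (hΩ : IsOpen Ω) (hu : IsSobolevW12 Ω u Du)
    (hp : IsSobolevH10 Ω Γ (fun x => max (u x) 0) Df) :
    ∀ᵐ x ∂volume.restrict Ω, inner ℝ (Du x) (Df x) = ‖Df x‖ ^ 2 := by
  -- The product rule for `u⁺(u⁺ - u) = 0` identifies the two gradients where `u > 0`; elsewhere
  -- `Df` vanishes because `u⁺` does.
  have hmul : ∀ x, max (u x) 0 * (max (u x) 0 - u x) = 0 := fun x => by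
    rcases le_total (u x) 0 with h | h <;> simp [h]
  filter_upwards [hp.product_rule_of_mul_eq_zero hΩ (hp.sobolev.sub hu) hmul,
    hp.grad_eq_zero_of_eq_zero hΩ] with x h1 h2
  by_cases h0 : max (u x) 0 = 0
  · simp [h2 h0]
  · have h3 : max (u x) 0 - u x = 0 := (mul_eq_zero.1 (hmul x)).resolve_left h0
    rw [h3, zero_smul, add_zero, smul_eq_zero] at h1
    rw [← sub_eq_zero.1 (h1.resolve_left h0), real_inner_self_eq_norm_sq]

end Sobolev

/-! ### The maximum principle -/

theorem lemma2p5 (n : ℕ) (hn : 2 ≤ n) (c₀ : ℝ) (hc₀ : 0 < c₀) :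
    ∃ η : ℝ, 0 < η ∧
      ∀ (β : ℝ), β ∈ Ioo 0 (2 * Real.pi) →
      ∀ (Ω Γ₁ : Set (EuclideanSpace ℝ (Fin n))), IsOpen Ω → Ω ⊆ sector n β →
        Γ₁ ⊆ frontier Ω ∩ frontier (sector n β) →
      ∀ c : EuclideanSpace ℝ (Fin n) → ℝ, MemLp c ⊤ (volume.restrict Ω) →
        eLpNorm (fun x => max (c x) 0) ⊤ (volume.restrict Ω) < ENNReal.ofReal c₀ →
      ∀ (w : EuclideanSpace ℝ (Fin n) → ℝ)
        (Dw : EuclideanSpace ℝ (Fin n) → EuclideanSpace ℝ (Fin n)),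
        IsSobolevW12 Ω w Dw →
        (∃ Dwp : EuclideanSpace ℝ (Fin n) → EuclideanSpace ℝ (Fin n),
          IsSobolevH10 Ω Γ₁ (fun x => max (w x) 0) Dwp) →
        (∀ (φ : EuclideanSpace ℝ (Fin n) → ℝ)
          (Dφ : EuclideanSpace ℝ (Fin n) → EuclideanSpace ℝ (Fin n)),
          IsSobolevH10 Ω Γ₁ φ Dφ → (∀ᵐ x ∂(volume.restrict Ω), 0 ≤ φ x) →
          (∫ x in Ω, inner ℝ (Dw x) (Dφ x)) - ∫ x in Ω, c x * w x * φ x ≤ 0) →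
        volume Ω < ENNReal.ofReal (η * β) →
        ∀ᵐ x ∂(volume.restrict Ω), w x ≤ 0 := by
  obtain ⟨m, rfl⟩ := Nat.exists_eq_add_of_le' hn
  -- This radius makes the Poincaré constant `4ρ²` equal to `1 / (2c₀)`, so that `∫ (w⁺)²` is at
  -- most half of itself.
  have hρ : 0 < Real.sqrt (1 / (8 * c₀)) := Real.sqrt_pos.2 (by positivity)
  have hρ2 : Real.sqrt (1 / (8 * c₀)) ^ 2 = 1 / (8 * c₀) := Real.sq_sqrt (by positivity)
  set ρ := Real.sqrt (1 / (8 * c₀))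
  obtain ⟨η, hη, hP⟩ := exists_poincare_sector (m := m) hρ
  refine ⟨η, hη, fun β hβ Ω Γ hΩ hΩs hΓ c hc hcc₀ w Dw hw ⟨Dp, hp⟩ hsub hvol => ?_⟩
  have hpm := hp.sobolev.memLp
  have hpoinc : ∫ x in Ω, ‖max (w x) 0‖ ^ 2 ≤ (2 * ρ) ^ 2 * ∫ x in Ω, ‖Dp x‖ ^ 2 := by
    refine hp.integral_sq_le (by positivity) fun Φ h1 h2 => ?_
    convert hP β hβ Ω Γ hΩ hΩs hΓ hvol Φ h1 h2 using 2
    rw [ENNReal.ofReal_mul zero_le_two, mul_pow, ENNReal.ofReal_ofNat]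
    norm_num
  have htest := hsub _ Dp hp (Eventually.of_forall fun x => le_max_right _ _)
  rw [integral_congr_ae (hp.inner_grad_posPart hΩ hw)] at htest
  have hsq : Integrable (fun x => ‖max (w x) 0‖ ^ 2) (volume.restrict Ω) := hpm.integrable_norm_pow
    two_ne_zero
  have hcle : ∀ᵐ x ∂volume.restrict Ω, c x ≤ c₀ := by
    rw [eLpNorm_exponent_top] at hcc₀
    filter_upwards [ae_le_eLpNormEssSup (f := fun x => max (c x) 0) (μ := volume.restrict Ω)]
      with x hx
    have h := hx.trans hcc₀.le
    rw [← ofReal_norm, ENNReal.ofReal_le_ofReal_iff hc₀.le] at h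
    exact (le_max_left _ _).trans ((le_abs_self _).trans h)
  have hbound : ∫ x in Ω, c x * w x * max (w x) 0 ≤ c₀ * ∫ x in Ω, ‖max (w x) 0‖ ^ 2 := by
    rw [← integral_const_mul]
    refine integral_mono_ae ?_ (hsq.const_mul c₀) ?_
    · have hcw : MemLp (fun x => c x * w x) 2 (volume.restrict Ω) := hw.memLp.smul hc
      exact hcw.integrable_smul_two hpm
    · filter_upwards [hcle] with x hx
      have e : c x * w x * max (w x) 0 = c x * ‖max (w x) 0‖ ^ 2 := by
        rw [Real.norm_eq_abs, sq_abs]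
        rcases le_total (w x) 0 with h | h
        · simp [h]
        · rw [max_eq_left h]; ring
      rw [e]
      exact mul_le_mul_of_nonneg_right hx (sq_nonneg _)
  have hzero : ∫ x in Ω, ‖max (w x) 0‖ ^ 2 = 0 := by
    refine le_antisymm ?_ (integral_nonneg fun x => sq_nonneg _)
    have h1 : ∫ x in Ω, ‖Dp x‖ ^ 2 ≤ c₀ * ∫ x in Ω, ‖max (w x) 0‖ ^ 2 := by linarith
    have h2 : (2 * ρ) ^ 2 * (c₀ * ∫ x in Ω, ‖max (w x) 0‖ ^ 2) =
        (∫ x in Ω, ‖max (w x) 0‖ ^ 2) / 2 := by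
      rw [mul_pow, hρ2]; field_simp; norm_num
    have h3 := hpoinc.trans (mul_le_mul_of_nonneg_left h1 (sq_nonneg (2 * ρ)))
    linarith
  rw [integral_eq_zero_iff_of_nonneg (fun x => sq_nonneg _) hsq] at hzero
  filter_upwards [hzero] with x hx
  have hx0 : max (w x) 0 = 0 := by simpa using hx
  exact (le_max_left _ _).trans hx0.le
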